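/- Let $\Gamma$ be a finite simplicial graph with vertex set $V$ in which every edge $\{s,t\}$ carries an integer $m_{st}\ge 2$ (put $m_{st}=\infty$ if $s\ne t$ are not joined by an edge), and let $$A_\Gamma=\langle V \mid \underbrace{sts\cdots}_{m_{st}}=\underbrace{tst\cdots}_{m_{st}}\ \text{for every edge } \{s,t\}\rangle$$ be its Artin group. Assume that the rank $|V|$ is at least $3$ and that $A_\Gamma$ is $2$-dimensional, i.e. the largest cardinality of a subset $T\subseteq V$ for which the Coxeter group of the full labelled subgraph spanned by $T$ is finite equals $2$. For $T \subseteq V$ let $A_T$ be the subgroup of $A_\Gamma$ generated by $T$ (so $A_\emptyset=\{1\}$, $A_{\{s\}}=\langle s\rangle$, and write $A_{st}=A_{\{s,t\}}$). The modified Deligne complex $D_\Gamma$ is the simplicial complex whose vertices are the pairs $gv_T:=(T,gA_T)$, where $g\in A_\Gamma$ and $T$ is $\emptyset$, $\{s\}$, or $\{s,t\}$ with $s\neq t$ and $m_{st}<\infty$, and whose simplices are the finite nonempty sets $\{gv_{T}: T\in c\}$ with $g\in A_\Gamma$ and $c$ a chain of such sets $T$ for inclusion. The group $A_\Gamma$ acts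 on it by left multiplication, and the stabiliser of $v_{st}:=v_{\{s,t\}}$ is $A_{st}$. The link $\mathrm{Lk}(v_{st})$ is the graph formed by the simplices of $D_\Gamma$ that do not contain $v_{st}$ but are contained in a simplex containing $v_{st}$; it carries the angular metric, that is, the length metric for which every edge has length equal to the angle $\frac{\pi}{2m_{st}}$ at $v_{st}$ of the corresponding triangle for the Moussong metric of $D_\Gamma$. Let $a,b\in V$ satisfy $3\le m_{ab}<\infty$. For $g\in A_{ab}$ let $\ell_{\mathcal S}(g)$ be its syllabic length: the least $n$ such that $g=a_1^{r_1}\cdots a_n^{r_n}$ with $a_i\in\{a,b\}$, $a_i\ne a_{i+1}$ and $r_i\in\mathbb Z\setminus\{0\}$. Then: 1. The orbits of $A_{ab}$ on $\mathrm{Lk}(v_{ab})$ are unbounded. 2. For every $g\in A_{ab}$ and every point $x\in\mathrm{Lk}(v_{ab})$, the orbit map $\mathbb Z\to \mathrm{Lk}(v_{ab})$, $n\mapsto g^n x$, is a quasi-isometric embedding if and only if $g$ is nontrivial and is not conjugate in $A_{ab}$ to a power of $a$ or of $b$. 3. The set $\{\ell_{\mathcal S}(g) : g\in A_{ab}\}$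 is unbounded. 4. For every $g\in A_{ab}$, the sequence $(\ell_{\mathcal S}(g^n))_{n\ge 0}$ grows linearly (there are constants $B\ge A>0$ and $C\ge 0$ with $An-C\le \ell_{\mathcal S}(g^n)\le Bn+C$ for all $n\ge 0$) if and only if $g$ is nontrivial and is not conjugate in $A_{ab}$ to a power of $a$ or of $b$. -/

import Mathlib

open scoped NNReal ENNReal

noncomputable section

namespace ArtinDeligne

/-! ### Artin groups

The labelled defining graph is encoded by a Mathlib `CoxeterMatrix V`: two distinct vertices `a`, `b`
are joined by an edge with coefficient `M a b ≥ 2` when `M a b ≠ 0`, and `M a b = 0` means that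
there is no edge, that is, `m_ab = ∞`. The diagonal entries are equal to `1`. -/

/-- The alternating product `s t s ⋯` with `n` factors. -/
def altProd {G : Type*} [Monoid G] (s t : G) : ℕ → G
  | 0 => 1
  | n + 1 => s * altProd t s n

variable {V : Type*}

/-- The relators of the Artin group, one for each (oriented) edge of the defining graph. -/
def artinRelators (M : CoxeterMatrix V) : Set (FreeGroup V) :=
  {r | ∃ a b : V, a ≠ b ∧ M a b ≠ 0 ∧
    r = altProd (FreeGroup.of a) (FreeGroup.of b) (M a b) *
      (altProd (FreeGroup.of b) (FreeGroup.of a) (M a b))⁻¹}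

/-- The Artin group `A_Γ`. -/
abbrev ArtinGroup (M : CoxeterMatrix V) : Type _ := PresentedGroup (artinRelators M)

/-- The standard generator of the Artin group attached to a vertex of the defining graph. -/
def gen (M : CoxeterMatrix V) (a : V) : ArtinGroup M := PresentedGroup.of a

/-- The Coxeter matrix of the full labelled subgraph spanned by `T`. -/
def restrict (M : CoxeterMatrix V) (T : Finset V) : CoxeterMatrix T where
  M := M.M.submatrix Subtype.val Subtype.val
  isSymm := M.isSymm.submatrix _
  diagonal i := M.diagonal i
  off_diagonal i j h := M.off_diagonal i j (Subtype.val_injective.ne h)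

/-- The Artin group has dimension `d`: the maximal rank of a spherical standard Artin subgroup,
that is, one whose Coxeter group is finite, is `d`. -/
def HasDimension (M : CoxeterMatrix V) (d : ℕ) : Prop :=
  IsGreatest {n : ℕ | ∃ T : Finset V, T.card = n ∧ Finite (restrict M T).Group} d

/-! ### The modified Deligne complex -/

/-- The vertices of the fundamental domain `K_Γ`: `v_∅`, the `v_a`, and the `v_{ab}` with `a ≠ b`
and `m_ab < ∞`, given by the subsets `∅`, `{a}` and `{a, b}` of `V`. Its simplices are the finite
nonempty chains for inclusion. -/
def KVertex (M : CoxeterMatrix V) : Type _ :=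
  {σ : Finset V // σ.card ≤ 2 ∧ ∀ a ∈ σ, ∀ b ∈ σ, M a b ≠ 0}

/-- The vertex `v_{ab}` of `K_Γ`. -/
def pairVertex [DecidableEq V] (M : CoxeterMatrix V) (a b : V) (h : M a b ≠ 0) : KVertex M :=
  ⟨{a, b}, Finset.card_le_two, by
    have h' : M b a ≠ 0 := by rwa [M.symmetric]
    intro x hx y hy
    simp only [Finset.mem_insert, Finset.mem_singleton] at hx hy
    rcases hx with rfl | rfl <;> rcases hy with rfl | rfl <;> simp_all⟩

/-- The local group at a vertex of `K_Γ`: the subgroup `{1}`, `⟨a⟩` or `A_ab` of `A_Γ` generated by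
the corresponding standard generators. -/
def localGroup (M : CoxeterMatrix V) (σ : KVertex M) : Subgroup (ArtinGroup M) :=
  Subgroup.closure (gen M '' (σ.1 : Set V))

/-- The vertices of the modified Deligne complex `D_Γ = (A_Γ × K_Γ) / ∼`: pairs of a vertex of `K_Γ`
and a left coset of its local group. The group `A_Γ` acts by left multiplication (Mathlib's
instances on sigma types and quotients). -/
abbrev DVertex (M : CoxeterMatrix V) : Type _ :=
  Σ σ : KVertex M, ArtinGroup M ⧸ localGroup M σ

/-- The modified Deligne complex: its simplices are the translates `g · c`, where `g ∈ A_Γ` and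
`c` is a simplex of `K_Γ`. -/
def deligneComplex (M : CoxeterMatrix V) : AbstractSimplicialComplex (DVertex M) where
  faces := {s | s.Nonempty ∧ ∃ g : ArtinGroup M,
    (∀ u ∈ s, u.2 = (g : ArtinGroup M ⧸ localGroup M u.1)) ∧
    ∀ u ∈ s, ∀ w ∈ s, u.1.1 ⊆ w.1.1 ∨ w.1.1 ⊆ u.1.1}
  isRelLowerSet_faces := by
    rintro s ⟨hs, g, h₁, h₂⟩
    exact ⟨hs, fun t hts ht => ⟨ht, g, fun u hu => h₁ u (hts hu),
      fun u hu w hw => h₂ u (hts hu) w (hts hw)⟩⟩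
  singleton_mem := by
    rintro ⟨σ, q⟩
    obtain ⟨g, rfl⟩ := QuotientGroup.mk_surjective q
    refine ⟨by simp, g, ?_, ?_⟩
    · intro u hu
      obtain rfl := Finset.mem_singleton.1 hu
      rfl
    · intro u hu w hw
      rw [Finset.mem_singleton] at hu hw
      subst hu; subst hw
      exact Or.inl subset_rfl

/-- The vertex of `D_Γ` that corresponds to a vertex of the fundamental domain `K_Γ ⊆ D_Γ`. -/
def baseVertex (M : CoxeterMatrix V) (σ : KVertex M) : DVertex M :=
  ⟨σ, ((1 : ArtinGroup M) : ArtinGroup M ⧸ localGroup M σ)⟩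

/-- `A_Γ` acts on `D_Γ` by simplicial maps. -/
theorem map_smul_mem (M : CoxeterMatrix V) (g : ArtinGroup M) {s : Finset (DVertex M)}
    (hs : s ∈ (deligneComplex M).faces) :
    s.map (MulAction.toPerm g).toEmbedding ∈ (deligneComplex M).faces := by
  obtain ⟨hne, k, h₁, h₂⟩ := hs
  refine ⟨by simpa using hne, g * k, ?_, ?_⟩
  · intro u hu
    obtain ⟨⟨τ, q⟩, hw, rfl⟩ := Finset.mem_map.1 hu
    have : q = (k : ArtinGroup M ⧸ localGroup M τ) := h₁ _ hw
    subst this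
    rfl
  · intro u hu w hw
    obtain ⟨u', hu', rfl⟩ := Finset.mem_map.1 hu
    obtain ⟨w', hw', rfl⟩ := Finset.mem_map.1 hw
    exact h₂ u' hu' w' hw'

/-- The stabiliser of a vertex of the fundamental domain is its local group. -/
theorem stabilizer_baseVertex (M : CoxeterMatrix V) (σ : KVertex M) :
    MulAction.stabilizer (ArtinGroup M) (baseVertex M σ) = localGroup M σ := by
  ext g
  have : g • baseVertex M σ = ⟨σ, ((g * 1 : ArtinGroup M) : ArtinGroup M ⧸ localGroup M σ)⟩ := rfl
  rw [MulAction.mem_stabilizer_iff, this, baseVertex, mul_one]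
  constructor
  · intro h
    have h' : ((g : ArtinGroup M) : ArtinGroup M ⧸ localGroup M σ) = ((1 : ArtinGroup M) : _) :=
      eq_of_heq (Sigma.mk.inj h).2
    rw [eq_comm, QuotientGroup.eq] at h'
    simpa using h'
  · intro h
    have h' : ((g : ArtinGroup M) : ArtinGroup M ⧸ localGroup M σ) = ((1 : ArtinGroup M) : _) := by
      rw [eq_comm, QuotientGroup.eq]
      simpa using h
    rw [h']

/-! ### Links and their angular metric -/

/-- The link of a vertex `v`: the simplices that do not contain `v` but are contained in a simplex
that contains `v`. -/
def link (M : CoxeterMatrix V) (v : DVertex M) : PreAbstractSimplicialComplex (DVertex M) where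
  faces := {s | s ∈ (deligneComplex M).faces ∧ v ∉ s ∧
    ∃ t ∈ (deligneComplex M).faces, v ∈ t ∧ s ⊆ t}
  isRelLowerSet_faces := by
    rintro s ⟨hs, hv, t, ht, hvt, hst⟩
    have key := (deligneComplex M).isRelLowerSet_faces hs
    exact ⟨key.1, fun r hrs hr => ⟨key.2 hrs hr, fun h => hv (hrs h), t, ht, hvt, hrs.trans hst⟩⟩

/-- A point of the (geometric realisation of the) link of `v`, in barycentric coordinates. -/
@[ext]
structure LinkPoint (M : CoxeterMatrix V) (v : DVertex M) where
  coord : DVertex M →₀ ℝ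
  nonneg : ∀ u, 0 ≤ coord u
  sum_eq_one : (coord.sum fun _ t => t) = 1
  support_mem : coord.support ∈ (link M v).faces

/-- For `σ = {a, b}` this is the coefficient `m_ab`. -/
def coeff (M : CoxeterMatrix V) (σ : Finset V) : ℕ :=
  σ.sup fun a => σ.sup fun b => M a b

/-- The angle at the vertex `v` of the triangle with vertices `v`, `u`, `w` in the Moussong metric:
in the triangle `v_∅`, `v_a`, `v_{ab}`, the angle is `π/2 - π/(2 m_ab)` at `v_∅`, it is `π/2` at
`v_a`, and it is `π/(2 m_ab)` at `v_{ab}`. -/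
def angle [DecidableEq V] (M : CoxeterMatrix V) (v u w : DVertex M) : ℝ :=
  let m : ℝ := coeff M (v.1.1 ∪ u.1.1 ∪ w.1.1)
  match v.1.1.card with
  | 0 => Real.pi / 2 - Real.pi / (2 * m)
  | 1 => Real.pi / 2
  | _ => Real.pi / (2 * m)

/-- `x` and `y` lie in a common closed simplex of the link of `v`, at distance `ℓ` in it. As `D_Γ`
has dimension `2`, that simplex is a vertex (`u = w`) or an edge with ends `u ≠ w`; the edge is an
arc whose length is the angle at `v` of the triangle `v`, `u`, `w`, and the coordinate at `u` is an
affine function on it. -/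
def ArcStep [DecidableEq V] (M : CoxeterMatrix V) (v : DVertex M) (x y : LinkPoint M v) (ℓ : ℝ) :
    Prop :=
  ∃ s ∈ (link M v).faces, ∃ u w : DVertex M, (s : Set (DVertex M)) = {u, w} ∧
    x.coord.support ⊆ s ∧ y.coord.support ⊆ s ∧ ℓ = angle M v u w * |x.coord u - y.coord u|

/-- There is a piecewise geodesic path of length `L` from `x` to `y` in the link: a finite chain of
points, any two consecutive ones in a common closed simplex. -/
inductive IsString [DecidableEq V] (M : CoxeterMatrix V) (v : DVertex M) :
    LinkPoint M v → LinkPoint M v → ℝ → Prop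
  | nil (x : LinkPoint M v) : IsString M v x x 0
  | cons {x y z : LinkPoint M v} {ℓ L : ℝ} (h : ArcStep M v x y ℓ) (h' : IsString M v y z L) :
      IsString M v x z (ℓ + L)

section metric

variable [DecidableEq V] {M : CoxeterMatrix V} {v : DVertex M}

theorem ArcStep.symm {x y : LinkPoint M v} {ℓ : ℝ} (h : ArcStep M v x y ℓ) : ArcStep M v y x ℓ := by
  obtain ⟨s, hs, u, w, he, hx, hy, rfl⟩ := h
  exact ⟨s, hs, u, w, he, hy, hx, by rw [abs_sub_comm]⟩

theorem angle_nonneg (u w : DVertex M) : 0 ≤ angle M v u w := by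
  have hpi := Real.pi_pos
  have key : ∀ n : ℕ, 0 ≤ Real.pi / 2 - Real.pi / (2 * (n : ℝ)) := by
    intro n
    rcases Nat.eq_zero_or_pos n with rfl | hn
    · simp; positivity
    · have h1 : (1 : ℝ) ≤ n := by exact_mod_cast hn
      have : Real.pi / (2 * (n : ℝ)) ≤ Real.pi / 2 :=
        div_le_div_of_nonneg_left hpi.le (by norm_num) (by linarith)
      linarith
  unfold angle
  dsimp only
  split
  · exact key _
  · positivity
  · positivity

theorem ArcStep.nonneg {x y : LinkPoint M v} {ℓ : ℝ} (h : ArcStep M v x y ℓ) : 0 ≤ ℓ := by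
  obtain ⟨s, hs, u, w, he, hx, hy, rfl⟩ := h
  exact mul_nonneg (angle_nonneg u w) (abs_nonneg _)

theorem IsString.nonneg {x y : LinkPoint M v} {L : ℝ} (h : IsString M v x y L) : 0 ≤ L := by
  induction h with
  | nil x => exact le_rfl
  | cons h _ ih => exact add_nonneg h.nonneg ih

theorem IsString.trans {x y z : LinkPoint M v} {L L' : ℝ} (h : IsString M v x y L)
    (h' : IsString M v y z L') : IsString M v x z (L + L') := by
  induction h with
  | nil x => simpa using h'
  | cons h _ ih => rw [add_assoc]; exact IsString.cons h (ih h')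

theorem IsString.symm {x y : LinkPoint M v} {L : ℝ} (h : IsString M v x y L) :
    IsString M v y x L := by
  induction h with
  | nil x => exact IsString.nil x
  | cons h _ ih =>
    have := ih.trans (IsString.cons h.symm (IsString.nil _))
    rwa [add_zero, add_comm] at this

/-- The angular (length) metric on the link of `v`: the infimum of the lengths of the piecewise
geodesic paths. -/
instance : PseudoEMetricSpace (LinkPoint M v) where
  edist x y := ⨅ (L : ℝ) (_ : IsString M v x y L), ENNReal.ofReal L
  edist_self x := by
    refine le_antisymm ?_ zero_le
    exact (iInf₂_le 0 (IsString.nil x)).trans (by simp)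
  edist_comm x y := by
    refine le_antisymm ?_ ?_ <;>
    exact le_iInf₂ fun L h => iInf₂_le L h.symm
  edist_triangle x y z := by
    refine ENNReal.le_of_forall_pos_le_add fun ε hε hlt => ?_
    have hε' : (0 : ℝ≥0∞) < (ε / 2 : ℝ≥0) := by exact_mod_cast half_pos hε
    obtain ⟨h1, h2⟩ := ENNReal.add_lt_top.1 hlt
    have a1 := ENNReal.lt_add_right h1.ne hε'.ne'
    have a2 := ENNReal.lt_add_right h2.ne hε'.ne'
    obtain ⟨L, hL⟩ := iInf_lt_iff.1 a1
    obtain ⟨hL, hL'⟩ := iInf_lt_iff.1 hL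
    obtain ⟨K, hK⟩ := iInf_lt_iff.1 a2
    obtain ⟨hK, hK'⟩ := iInf_lt_iff.1 hK
    refine (iInf₂_le (L + K) (hL.trans hK)).trans ?_
    rw [ENNReal.ofReal_add hL.nonneg hK.nonneg]
    refine (add_le_add hL'.le hK'.le).trans (le_of_eq ?_)
    rw [add_add_add_comm, ← ENNReal.coe_add, add_halves]

end metric

theorem map_mem_link (M : CoxeterMatrix V) {v : DVertex M} {g : ArtinGroup M} (hg : g • v = v)
    {s : Finset (DVertex M)} (hs : s ∈ (link M v).faces) :
    s.map (MulAction.toPerm g).toEmbedding ∈ (link M v).faces := by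
  obtain ⟨hs, hv, t, ht, hvt, hst⟩ := hs
  refine ⟨map_smul_mem M g hs, ?_, _, map_smul_mem M g ht, ?_, Finset.map_subset_map.2 hst⟩
  · intro h
    obtain ⟨w, hw, hwv⟩ := Finset.mem_map.1 h
    have hwv' : g • w = g • v := by rw [hg]; exact hwv
    rw [smul_left_cancel_iff] at hwv'
    exact hv (hwv' ▸ hw)
  · exact Finset.mem_map.2 ⟨v, hvt, hg⟩

/-- The stabiliser of `v` acts on the link of `v`, by the simplicial action on vertices. -/
instance (M : CoxeterMatrix V) (v : DVertex M) :
    MulAction (MulAction.stabilizer (ArtinGroup M) v) (LinkPoint M v) where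
  smul g x :=
    { coord := x.coord.equivMapDomain (MulAction.toPerm (g : ArtinGroup M))
      nonneg := fun u => by
        rw [Finsupp.equivMapDomain_apply]
        exact x.nonneg _
      sum_eq_one := by
        rw [Finsupp.equivMapDomain_eq_mapDomain, Finsupp.sum_mapDomain_index (by simp) (by simp)]
        exact x.sum_eq_one
      support_mem := map_mem_link M g.2 x.support_mem }
  one_smul x := by
    ext u
    change x.coord ((1 : ArtinGroup M)⁻¹ • u) = x.coord u
    rw [inv_one, one_smul]
  mul_smul g h x := by
    ext u
    change x.coord ((g * h : ArtinGroup M)⁻¹ • u) =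
      x.coord ((h : ArtinGroup M)⁻¹ • (g : ArtinGroup M)⁻¹ • u)
    rw [mul_inv_rev, mul_smul]

/-- The local group at a vertex of the fundamental domain, which is its stabiliser, acts on the
link of that vertex. -/
instance (M : CoxeterMatrix V) (σ : KVertex M) :
    MulAction (localGroup M σ) (LinkPoint M (baseVertex M σ)) :=
  MulAction.compHom _ (Subgroup.inclusion (stabilizer_baseVertex M σ).ge)

/-! ### Quasi-isometric embeddings, linear growth and syllabic length -/

/-- Quasi-isometric embeddings: `d(x, y) / K - C ≤ d(f x, f y) ≤ K d(x, y) + C`. -/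
def IsQuasiIsometricEmbedding {X Y : Type*} [PseudoEMetricSpace X] [PseudoEMetricSpace Y]
    (f : X → Y) : Prop :=
  ∃ K C : ℝ≥0, 1 ≤ K ∧ ∀ x y : X,
    edist x y / K ≤ edist (f x) (f y) + C ∧ edist (f x) (f y) ≤ K * edist x y + C

/-- The sequence `u` grows linearly. -/
def GrowsLinearly (u : ℕ → ℕ) : Prop :=
  ∃ A B C : ℝ, 0 < A ∧ A ≤ B ∧ 0 ≤ C ∧
    ∀ n : ℕ, A * n - C ≤ u n ∧ (u n : ℝ) ≤ B * n + C

/-- The syllabic length, with respect to a set `S` of letters in a group, of an element `g` of the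
subgroup generated by `S`: the least `n` such that `g` is represented by a word
`a₁ ^ r₁ ⋯ aₙ ^ rₙ` with `aᵢ ∈ S`, `aᵢ ≠ aᵢ₊₁` and `rᵢ ∈ ℤ ∖ {0}`. -/
def syllabicLength {G : Type*} [Group G] (S : Set G) (g : G) : ℕ :=
  sInf {n : ℕ | ∃ w : List (G × ℤ), (∀ p ∈ w, p.1 ∈ S ∧ p.2 ≠ 0) ∧
    w.IsChain (fun p q => p.1 ≠ q.1) ∧ (w.map fun p => p.1 ^ p.2).prod = g ∧ w.length = n}

end ArtinDeligne

end

/-!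
The subgroup `A_ab`, with `m = m_ab`, is compared with the free product `ℤ/2 * ℤ/m`, with
generators `flip` of order `2` and `rot 1` of order `m`. In it `a ↦ rot 1 * flip`,
`b ↦ flip * rot 1` satisfy the braid relation, and together with the length homomorphism to `ℤ` they
define an embedding of the dihedral Artin group (`eq_one_of_map_eq_one`, by Garside normal forms).

That the map is defined on the subgroup `A_ab` of `A_Γ`, and not only on the abstract dihedral Artin
group, comes from a representation of `A_Γ` by transvections of `ℝ^V` for an alternating form with
`ω(s, t) = ± 2 cos (π / m_st)`. On the plane spanned by `e_a` and `e_b` it is given by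
`!![1, c; 0, 1]` and `!![1, 0; -c, 1]` with `c = 2 cos (π / m)`, and a ping-pong argument identifies
the group generated by the corresponding quarter turn and rotation of order `m`, modulo `± 1`, with
`ℤ/2 * ℤ/m` (`exists_faithful_action`, `exists_hom_hecke`).

Two functions bound the syllabic length from below (`invariants_le_syllabicLength`). Both are defined
from the exponents of `rot 1` in reduced words of `ℤ/2 * ℤ/m`, and both vanish on the
powers of `a` and `b`, whose reduced words have all exponents equal to `1` or all equal to `-1`.
The first is the number of breaks, that is, of adjacent exponents that are not both `1` or both `-1`.
The second is the quasi-morphism that subtracts from the length the number of exponents `1` and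
adds the number of exponents `-1`. By cyclic reduction (`Hecke.trichotomy`), the image of an element
`g` in the free product either is conjugate into a factor or to a power of `rot 1 * flip`, or its powers
have linearly many breaks. In the first two cases the quasi-morphism grows linearly along the powers
of `g`, unless `g` is trivial or conjugate to a power of `a` or `b` (`exists_linear_lower_bound`).

The link of `v_ab` is the graph with edges between `g v_∅` and `g v_a`, `g v_b`, for `g` in `A_ab`,
all of the same length. The distance in it from `v_∅` to `g v_∅` is thus comparable to the syllabic
length of `g`: a syllable is crossed by two edges, and conversely the syllabic length of coset
representatives extends affinely to a Lipschitz function on the link (`exists_displacement_bounds`).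
Hence the statements on orbits follow from those on the syllabic length.
-/

namespace ArtinDeligne

/-! ### Syllabic length -/

section Syllables

variable {G : Type*} [Group G] {S : Set G}

/-- A word in powers of letters can be shortened to a reduced one: adjacent powers of a letter are
merged and trivial powers are removed. -/
theorem exists_reduced_syllables (w : List (G × ℤ)) (hw : ∀ p ∈ w, p.1 ∈ S) :
    ∃ w' : List (G × ℤ), (∀ p ∈ w', p.1 ∈ S ∧ p.2 ≠ 0) ∧ w'.IsChain (fun p q => p.1 ≠ q.1) ∧
      (w'.map fun p => p.1 ^ p.2).prod = (w.map fun p => p.1 ^ p.2).prod ∧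
      w'.length ≤ w.length := by
  induction w with
  | nil => exact ⟨[], by simp, by simp, rfl, le_rfl⟩
  | cons p w ih =>
    obtain ⟨w', h1, h2, h3, h4⟩ := ih fun q hq => hw q (List.mem_cons_of_mem _ hq)
    have hp := hw p List.mem_cons_self
    rcases eq_or_ne p.2 0 with h0 | h0
    · exact ⟨w', h1, h2, by simp [h0, h3], by simp; omega⟩
    match w', h1, h2, h3, h4 with
    | [], _, _, h3, _ =>
      exact ⟨[p], by simp [hp, h0], by simp, by simpa using h3.symm, by simp⟩
    | q :: l, h1, h2, h3, h4 =>
      have hl : ∀ r ∈ l, r.1 ∈ S ∧ r.2 ≠ 0 := fun r hr => h1 r (List.mem_cons_of_mem _ hr)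
      simp only [List.map_cons, List.prod_cons, List.length_cons] at h3 h4 ⊢
      rcases eq_or_ne p.1 q.1 with hpq | hpq
      · rcases eq_or_ne (p.2 + q.2) 0 with hs | hs
        · refine ⟨l, hl, h2.tail, ?_, by omega⟩
          rw [← h3, hpq, ← mul_assoc, ← zpow_add, hs, zpow_zero, one_mul]
        · refine ⟨(p.1, p.2 + q.2) :: l, ?_, ?_, ?_, by simp; omega⟩
          · intro r hr
            rcases List.mem_cons.1 hr with rfl | hr
            exacts [⟨hp, hs⟩, hl r hr]
          · cases l with
            | nil => simp
            | cons r l =>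
              rw [List.isChain_cons_cons] at h2 ⊢
              exact ⟨hpq ▸ h2.1, h2.2⟩
          · simp only [List.map_cons, List.prod_cons]
            rw [← h3, hpq, ← mul_assoc, ← zpow_add]
      · refine ⟨p :: q :: l, ?_, ?_, ?_, by simp; omega⟩
        · intro r hr
          rcases List.mem_cons.1 hr with rfl | hr
          exacts [⟨hp, h0⟩, h1 r hr]
        · exact List.isChain_cons_cons.2 ⟨hpq, h2⟩
        · simp only [List.map_cons, List.prod_cons]
          rw [← h3]

theorem syllabicLength_le (w : List (G × ℤ)) (hw : ∀ p ∈ w, p.1 ∈ S) :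
    syllabicLength S (w.map fun p => p.1 ^ p.2).prod ≤ w.length := by
  obtain ⟨w', h1, h2, h3, h4⟩ := exists_reduced_syllables w hw
  refine le_trans (Nat.sInf_le ?_) h4
  exact ⟨w', h1, h2, h3, rfl⟩

theorem exists_syllables {g : G} (hg : g ∈ Subgroup.closure S) :
    ∃ w : List (G × ℤ), (∀ p ∈ w, p.1 ∈ S) ∧ (w.map fun p => p.1 ^ p.2).prod = g ∧
      w.length = syllabicLength S g := by
  have key : ∃ w : List (G × ℤ), (∀ p ∈ w, p.1 ∈ S) ∧ (w.map fun p => p.1 ^ p.2).prod = g := by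
    rw [← Subgroup.mem_toSubmonoid, Subgroup.closure_toSubmonoid] at hg
    obtain ⟨l, hl, rfl⟩ := Submonoid.exists_list_of_mem_closure hg
    clear hg
    induction l with
    | nil => exact ⟨[], by simp, rfl⟩
    | cons x l ih =>
      obtain ⟨w, hw, hw'⟩ := ih fun y hy => hl y (List.mem_cons_of_mem _ hy)
      rcases hl x List.mem_cons_self with hx | hx
      · refine ⟨(x, 1) :: w, ?_, by simp [hw']⟩
        intro p hp
        rcases List.mem_cons.1 hp with rfl | hp
        exacts [hx, hw p hp]
      · refine ⟨(x⁻¹, -1) :: w, ?_, by simp [hw']⟩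
        intro p hp
        rcases List.mem_cons.1 hp with rfl | hp
        exacts [hx, hw p hp]
  obtain ⟨w, hw, hg⟩ := key
  obtain ⟨w', h1, h2, h3, -⟩ := exists_reduced_syllables w hw
  obtain ⟨w₀, k1, -, k3, k4⟩ := Nat.sInf_mem
    (s := {n : ℕ | ∃ w : List (G × ℤ), (∀ p ∈ w, p.1 ∈ S ∧ p.2 ≠ 0) ∧
      w.IsChain (fun p q => p.1 ≠ q.1) ∧ (w.map fun p => p.1 ^ p.2).prod = g ∧ w.length = n})
    ⟨_, w', h1, h2, h3.trans hg, rfl⟩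
  exact ⟨w₀, fun p hp => (k1 p hp).1, k3, k4⟩

theorem syllabicLength_mul_le {g h : G} (hg : g ∈ Subgroup.closure S)
    (hh : h ∈ Subgroup.closure S) :
    syllabicLength S (g * h) ≤ syllabicLength S g + syllabicLength S h := by
  obtain ⟨w, hw, rfl, hl⟩ := exists_syllables hg
  obtain ⟨w', hw', rfl, hl'⟩ := exists_syllables hh
  rw [← hl, ← hl', ← List.length_append, ← List.prod_append, ← List.map_append]
  refine syllabicLength_le _ fun p hp => ?_
  rcases List.mem_append.1 hp with h | h
  exacts [hw p h, hw' p h]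

theorem syllabicLength_one : syllabicLength S (1 : G) = 0 :=
  Nat.le_zero.1 (syllabicLength_le (S := S) [] (by simp))

theorem syllabicLength_zpow_le {s : G} (hs : s ∈ S) (k : ℤ) : syllabicLength S (s ^ k) ≤ 1 := by
  simpa using syllabicLength_le (S := S) [(s, k)] (by simpa using hs)

theorem syllabicLength_pow_le {g : G} (hg : g ∈ Subgroup.closure S) (n : ℕ) :
    syllabicLength S (g ^ n) ≤ n * syllabicLength S g := by
  induction n with
  | zero => simp [syllabicLength_one]
  | succ n ih =>
    rw [pow_succ, add_mul, one_mul]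
    exact (syllabicLength_mul_le (pow_mem hg n) hg).trans (by omega)

/-- Induction over the syllables of an element, which are appended on the right. -/
theorem syllables_induction {P : G → ℕ → Prop} (one : P 1 0)
    (mul_zpow : ∀ g ∈ Subgroup.closure S, ∀ n, P g n → ∀ s ∈ S, ∀ k : ℤ, P (g * s ^ k) (n + 1))
    {g : G} (hg : g ∈ Subgroup.closure S) : P g (syllabicLength S g) := by
  obtain ⟨w, hw, rfl, hl⟩ := exists_syllables hg
  rw [← hl]
  clear hl hg
  induction w using List.reverseRecOn with
  | nil => simpa using one
  | append_singleton w p ih =>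
    have hw' : ∀ q ∈ w, q.1 ∈ S := fun q hq => hw q (List.mem_append_left _ hq)
    have := mul_zpow _ (Subgroup.list_prod_mem _ ?_) _ (ih hw') p.1 (hw p (by simp)) p.2
    · simpa using this
    · intro x hx
      obtain ⟨q, hq, rfl⟩ := List.mem_map.1 hx
      exact zpow_mem (Subgroup.subset_closure (hw' q hq)) _

end Syllables

/-! ### Reduced words in free products -/

section ReducedWords

open Monoid

variable {ι : Type*} {H : ι → Type*} [∀ i, Group (H i)]

/-- A word in a free product of groups is reduced if its letters are nontrivial and adjacent letters
belong to different factors. -/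
def IsReduced (l : List (Σ i, H i)) : Prop :=
  (∀ x ∈ l, x.2 ≠ 1) ∧ l.IsChain fun x y => x.1 ≠ y.1

/-- The element of the free product that is represented by a word. -/
def wordProd (l : List (Σ i, H i)) : CoprodI H :=
  (l.map fun x => CoprodI.of x.2).prod

/-- The inverse word. -/
def wordInv (l : List (Σ i, H i)) : List (Σ i, H i) :=
  (l.map fun x => ⟨x.1, x.2⁻¹⟩).reverse

@[simp] theorem wordProd_nil : wordProd ([] : List (Σ i, H i)) = 1 := rfl

@[simp] theorem wordProd_cons (x : Σ i, H i) (l : List (Σ i, H i)) :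
    wordProd (x :: l) = CoprodI.of x.2 * wordProd l := by simp [wordProd]

@[simp] theorem wordProd_append (l l' : List (Σ i, H i)) :
    wordProd (l ++ l') = wordProd l * wordProd l' := by simp [wordProd]

theorem wordProd_replicate (l : List (Σ i, H i)) (k : ℕ) :
    wordProd (List.replicate k l).flatten = wordProd l ^ k := by
  induction k with
  | zero => simp
  | succ k ih => simp [List.replicate_succ, ih, pow_succ']

theorem wordInv_append (l l' : List (Σ i, H i)) :
    wordInv (l ++ l') = wordInv l' ++ wordInv l := by simp [wordInv]

theorem exists_isReduced (q : CoprodI H) : ∃ l, IsReduced l ∧ wordProd l = q := by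
  classical
  obtain ⟨w, rfl⟩ := CoprodI.Word.equiv.symm.surjective q
  exact ⟨w.toList, ⟨fun x hx => w.ne_one x hx, w.chain_ne⟩, rfl⟩

theorem IsReduced.ext {l l' : List (Σ i, H i)} (hl : IsReduced l) (hl' : IsReduced l')
    (h : wordProd l = wordProd l') : l = l' := by
  classical
  have := CoprodI.Word.equiv.symm.injective (a₁ := (⟨l, hl.1, hl.2⟩ : CoprodI.Word H))
    (a₂ := ⟨l', hl'.1, hl'.2⟩) h
  exact congrArg CoprodI.Word.toList this

/-- The reduced word that represents an element of a free product. -/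
noncomputable def reducedWord (q : CoprodI H) : List (Σ i, H i) := (exists_isReduced q).choose

theorem isReduced_reducedWord (q : CoprodI H) : IsReduced (reducedWord q) :=
  (exists_isReduced q).choose_spec.1

@[simp] theorem wordProd_reducedWord (q : CoprodI H) : wordProd (reducedWord q) = q :=
  (exists_isReduced q).choose_spec.2

theorem IsReduced.reducedWord_wordProd {l : List (Σ i, H i)} (hl : IsReduced l) :
    reducedWord (wordProd l) = l :=
  (isReduced_reducedWord _).ext hl (wordProd_reducedWord _)

theorem isReduced_nil : IsReduced ([] : List (Σ i, H i)) := ⟨by simp, by simp⟩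

theorem isReduced_singleton {x : Σ i, H i} (hx : x.2 ≠ 1) : IsReduced [x] :=
  ⟨by simpa using hx, by simp⟩

theorem isReduced_append {l l' : List (Σ i, H i)} : IsReduced (l ++ l') ↔
    IsReduced l ∧ IsReduced l' ∧ ∀ x ∈ l.getLast?, ∀ y ∈ l'.head?, x.1 ≠ y.1 := by
  simp only [IsReduced, List.mem_append, List.isChain_append]
  grind

theorem isReduced_flatten_replicate {l : List (Σ i, H i)} (hl : IsReduced l)
    (h : ∀ x ∈ l.getLast?, ∀ y ∈ l.head?, x.1 ≠ y.1) (k : ℕ) :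
    IsReduced (List.replicate k l).flatten := by
  rcases eq_or_ne l [] with rfl | hne
  · simpa using isReduced_nil
  induction k with
  | zero => simpa using isReduced_nil
  | succ k ih =>
    rw [List.replicate_succ, List.flatten_cons, isReduced_append]
    refine ⟨hl, ih, fun x hx y hy => h x hx y ?_⟩
    cases k with
    | zero => simp at hy
    | succ k =>
      rw [List.replicate_succ, List.flatten_cons, List.head?_append_of_ne_nil _ hne] at hy
      exact hy

/-- In the product of two reduced words, an end of the first word cancels against a beginning of
the second one, and at most one pair of letters is merged at the place where they meet. -/
theorem IsReduced.exists_cancel {v : List (Σ i, H i)} (hv : IsReduced v) :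
    ∀ {w : List (Σ i, H i)}, IsReduced w → ∃ p c s : List (Σ i, H i),
      (w = p ++ c ∧ v = wordInv c ++ s ∧ IsReduced (p ++ s) ∧
        wordProd w * wordProd v = wordProd (p ++ s)) ∨
      ∃ (i : ι) (x y : H i), w = p ++ [⟨i, x⟩] ++ c ∧ v = wordInv c ++ [⟨i, y⟩] ++ s ∧
        IsReduced (p ++ [⟨i, x * y⟩] ++ s) ∧
        wordProd w * wordProd v = wordProd (p ++ [⟨i, x * y⟩] ++ s) := by
  induction v with
  | nil => exact fun {w} hw => ⟨w, [], [], Or.inl ⟨by simp, by simp [wordInv], by simpa, by simp⟩⟩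
  | cons b v ih =>
    intro w hw
    rcases List.eq_nil_or_concat' w with rfl | ⟨w, a, rfl⟩
    · exact ⟨[], [], b :: v, Or.inl ⟨by simp, by simp [wordInv], by simpa, by simp⟩⟩
    have hv' : IsReduced v := (isReduced_append (l := [b]).1 hv).2.1
    have hw' : IsReduced w := (isReduced_append.1 hw).1
    by_cases hab : a.1 = b.1
    · obtain ⟨i, x⟩ := a
      obtain ⟨j, y⟩ := b
      obtain rfl : i = j := hab
      by_cases hxy : x * y = 1
      · obtain rfl : y = x⁻¹ := (inv_eq_of_mul_eq_one_right hxy).symm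
        have hprod : wordProd (w ++ [⟨i, x⟩]) * wordProd (⟨i, x⁻¹⟩ :: v) =
            wordProd w * wordProd v := by simp [mul_assoc]
        rw [hprod]
        obtain ⟨p, c, s, h⟩ := ih hv' hw'
        refine ⟨p, c ++ [⟨i, x⟩], s, ?_⟩
        rcases h with ⟨rfl, rfl, h3, h4⟩ | ⟨j, x', y', rfl, rfl, h3, h4⟩
        · exact Or.inl ⟨by simp, by simp [wordInv], h3, h4⟩
        · exact Or.inr ⟨j, x', y', by simp, by simp [wordInv], h3, h4⟩
      · refine ⟨w, [], v, Or.inr ⟨i, x, y, by simp, by simp [wordInv], ?_, by simp [mul_assoc]⟩⟩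
        have h1 := (isReduced_append.1 hw).2.2
        have h2 := (isReduced_append (l := [⟨i, y⟩]).1 hv).2.2
        rw [isReduced_append, isReduced_append]
        refine ⟨⟨hw', isReduced_singleton hxy, fun z hz t ht => ?_⟩, hv', fun z hz t ht => ?_⟩
        · have := h1 z hz ⟨i, x⟩ (by simp)
          simp at ht
          subst ht
          exact this
        · have := h2 ⟨i, y⟩ (by simp) t ht
          simp at hz
          subst hz
          exact this
    · refine ⟨w ++ [a], [], b :: v, Or.inl ⟨by simp, by simp [wordInv], ?_, by simp [mul_assoc]⟩⟩
      rw [isReduced_append]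
      refine ⟨hw, hv, fun z hz t ht => ?_⟩
      simp at hz ht
      subst hz ht
      exact hab

/-- Cyclic reduction: up to conjugation, the reduced word of an element of a free product has at
most one letter, or its first and last letters belong to different factors. -/
theorem exists_cyclically_reduced (q : CoprodI H) :
    ∃ (h : CoprodI H) (l : List (Σ i, H i)), IsReduced l ∧ q = h * wordProd l * h⁻¹ ∧
      (l.length ≤ 1 ∨ ∀ x ∈ l.getLast?, ∀ y ∈ l.head?, x.1 ≠ y.1) := by
  obtain ⟨l, hl, rfl⟩ := exists_isReduced q
  induction hn : l.length using Nat.strong_induction_on generalizing l with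
  | _ n ih =>
    by_cases hcyc : l.length ≤ 1 ∨ ∀ x ∈ l.getLast?, ∀ y ∈ l.head?, x.1 ≠ y.1
    · exact ⟨1, l, hl, by simp, hcyc⟩
    push Not at hcyc
    obtain ⟨hlen, a, ha, b, hb, hab⟩ := hcyc
    match l, hl, hlen, ha, hb with
    | b' :: l', hl, hlen, ha, hb =>
      simp only [List.head?_cons, Option.mem_def, Option.some.injEq] at hb
      subst hb
      rcases List.eq_nil_or_concat' l' with rfl | ⟨l', a', rfl⟩
      · simp at hlen
      have : a = a' := by
        rw [← List.cons_append, List.getLast?_concat] at ha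
        simpa using ha.symm
      subst this
      obtain ⟨i, x⟩ := a
      obtain ⟨j, y⟩ := b'
      obtain rfl : i = j := hab
      have hl' : IsReduced (l' ++ [⟨i, x⟩]) := (isReduced_append (l := [_]).1 hl).2.1
      by_cases hxy : x * y = 1
      · obtain ⟨h, r, hr, hq, hc⟩ := ih _ (by rw [← hn]; simp) l'
          (isReduced_append.1 hl').1 rfl
        refine ⟨CoprodI.of y * h, r, hr, ?_, hc⟩
        obtain rfl : x = y⁻¹ := eq_inv_of_mul_eq_one_left hxy
        simp [hq, mul_assoc]
      · have hred : IsReduced (l' ++ [⟨i, x * y⟩]) := by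
          rw [isReduced_append] at hl' ⊢
          refine ⟨hl'.1, isReduced_singleton hxy, fun z hz t ht => ?_⟩
          simp at ht
          subst ht
          exact hl'.2.2 z hz ⟨i, x⟩ (by simp)
        obtain ⟨h, r, hr, hq, hc⟩ := ih _ (by rw [← hn]; simp) _ hred rfl
        refine ⟨CoprodI.of y * h, r, hr, ?_, hc⟩
        calc _ = CoprodI.of y * wordProd (l' ++ [⟨i, x * y⟩]) * (CoprodI.of y)⁻¹ := by
              simp [mul_assoc]
          _ = _ := by rw [hq]; simp [mul_assoc]

/-- The sum over the letters of reduced words of an odd function with values in `{-1, 0, 1}` is a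
quasi-morphism of defect at most `3`: the contributions of the cancelled parts are opposite, and the
only other letters that matter are the two that are merged and their product. -/
theorem abs_sum_reducedWord_mul_le (f : (Σ i, H i) → ℤ)
    (hodd : ∀ i (x : H i), f ⟨i, x⁻¹⟩ = -f ⟨i, x⟩)
    (hle : ∀ x, |f x| ≤ 1) (q r : CoprodI H) :
    |((reducedWord (q * r)).map f).sum - ((reducedWord q).map f).sum -
      ((reducedWord r).map f).sum| ≤ 3 := by
  have hinv : ∀ c : List (Σ i, H i), ((wordInv c).map f).sum = -(c.map f).sum := by
    intro c
    induction c with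
    | nil => simp [wordInv]
    | cons x c ih =>
      have := wordInv_append [x] c
      rw [List.singleton_append] at this
      rw [this, List.map_append, List.sum_append, ih]
      simp [wordInv, hodd]
  obtain ⟨p, c, s, h⟩ := (isReduced_reducedWord r).exists_cancel (isReduced_reducedWord q)
  simp only [wordProd_reducedWord] at h
  rcases h with ⟨h1, h2, h3, h4⟩ | ⟨i, x, y, h1, h2, h3, h4⟩
  · rw [h4, h3.reducedWord_wordProd, h1, h2]
    simp only [List.map_append, List.sum_append, hinv]
    ring_nf
    norm_num
  · rw [h4, h3.reducedWord_wordProd, h1, h2]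
    have h5 := hle ⟨i, x⟩
    have h6 := hle ⟨i, y⟩
    have h7 := hle ⟨i, x * y⟩
    simp only [List.map_append, List.sum_append, hinv, List.map_cons, List.map_nil, List.sum_cons,
      List.sum_nil]
    rw [abs_le] at *
    constructor <;> linarith

end ReducedWords

/-! ### The free product of cyclic groups of orders `2` and `m` -/

section FreeProduct

open Monoid

/-- The factors of `ℤ/2 * ℤ/m`: the factor `true` is `ℤ/m` and the factor `false` is `ℤ/2`. -/
abbrev Factor (m : ℕ) (i : Bool) : Type := Multiplicative (ZMod (bif i then m else 2))

/-- The free product `ℤ/2 * ℤ/m`. -/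
abbrev Hecke (m : ℕ) : Type := CoprodI (Factor m)

variable {m : ℕ}

/-- The letter of exponent `e` in the factor `ℤ/m`. -/
def rotLetter (e : ZMod m) : Σ i, Factor m i := ⟨true, Multiplicative.ofAdd e⟩

/-- The nontrivial letter of the factor `ℤ/2`. -/
def flipLetter (m : ℕ) : Σ i, Factor m i := ⟨false, Multiplicative.ofAdd (1 : ZMod 2)⟩

/-- The element of exponent `e` in the factor `ℤ/m`. -/
def rot (e : ZMod m) : Hecke m := CoprodI.of (rotLetter e).2

/-- The involution that generates the factor `ℤ/2`. -/
def flip (m : ℕ) : Hecke m := CoprodI.of (flipLetter m).2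

theorem rot_add (e e' : ZMod m) : rot (e + e') = rot e * rot e' :=
  map_mul (CoprodI.of (M := Factor m) (i := true))
    (Multiplicative.ofAdd e) (Multiplicative.ofAdd e')

theorem rot_zero : rot (0 : ZMod m) = 1 := map_one (CoprodI.of (M := Factor m) (i := true))

theorem rot_neg (e : ZMod m) : rot (-e) = (rot e)⁻¹ :=
  eq_inv_of_mul_eq_one_left (by rw [← rot_add, neg_add_cancel, rot_zero])

theorem rot_pow (e : ZMod m) (k : ℕ) : rot e ^ k = rot ((k : ZMod m) * e) := by
  induction k with
  | zero => simp [rot_zero]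
  | succ k ih => rw [pow_succ, ih, ← rot_add]; congr 1; push_cast; ring

@[simp] theorem flip_mul_flip : flip m * flip m = 1 := by
  have h : ((flipLetter m).2 * (flipLetter m).2 : Factor m false) = 1 := by
    change (Multiplicative.ofAdd ((1 : ZMod 2) + 1) : Multiplicative (ZMod 2)) = 1
    decide
  rw [flip, ← map_mul, h, map_one]

@[simp] theorem flip_inv : (flip m)⁻¹ = flip m := inv_eq_of_mul_eq_one_left flip_mul_flip

theorem rotLetter_ne_one {e : ZMod m} (he : e ≠ 0) : (rotLetter e).2 ≠ 1 := he

theorem flipLetter_ne_one : (flipLetter m).2 ≠ 1 := by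
  change (1 : ZMod 2) ≠ 0
  decide

theorem eq_flipLetter {x : Factor m false} (hx : x ≠ 1) :
    (⟨false, x⟩ : Σ i, Factor m i) = flipLetter m := by
  have h : ∀ y : ZMod 2, y ≠ 0 → y = 1 := by decide
  exact congrArg (Sigma.mk false) (h x hx)

/-- The exponents of the letters of a word that belong to the factor `ℤ/m`. -/
def exponents (l : List (Σ i, Factor m i)) : List (ZMod m) :=
  l.filterMap fun x => match x with
    | ⟨true, e⟩ => some (Multiplicative.toAdd e)
    | ⟨false, _⟩ => none

@[simp] theorem exponents_nil : exponents ([] : List (Σ i, Factor m i)) = [] := rfl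

@[simp] theorem exponents_rotLetter_cons (e : ZMod m) (l : List (Σ i, Factor m i)) :
    exponents (rotLetter e :: l) = e :: exponents l := rfl

@[simp] theorem exponents_flipLetter_cons (l : List (Σ i, Factor m i)) :
    exponents (flipLetter m :: l) = exponents l := rfl

@[simp] theorem exponents_append (l l' : List (Σ i, Factor m i)) :
    exponents (l ++ l') = exponents l ++ exponents l' := List.filterMap_append

theorem exponents_replicate (l : List (Σ i, Factor m i)) (k : ℕ) :
    exponents (List.replicate k l).flatten = (List.replicate k (exponents l)).flatten := by
  induction k with
  | zero => simp
  | succ k ih => simp [List.replicate_succ, ih]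

open Classical in
/-- The number of breaks of a sequence of exponents: of the adjacent pairs of entries other than
`1, 1` and `-1, -1`. -/
noncomputable def breaks : List (ZMod m) → ℕ
  | [] => 0
  | [_] => 0
  | e :: e' :: l => (if e = e' ∧ (e = 1 ∨ e = -1) then 0 else 1) + breaks (e' :: l)

theorem breaks_append (l l' : List (ZMod m)) :
    breaks l + breaks l' ≤ breaks (l ++ l') ∧ breaks (l ++ l') ≤ breaks l + breaks l' + 1 := by
  induction l with
  | nil => simp [breaks]
  | cons e l ih =>
    cases l with
    | nil =>
      cases l' with
      | nil => simp [breaks]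
      | cons e' l' => simp only [List.singleton_append, breaks]; split_ifs <;> omega
    | cons e' l =>
      simp only [List.cons_append, breaks] at ih ⊢
      omega

theorem breaks_replicate {e : ZMod m} (he : e = 1 ∨ e = -1) (k : ℕ) :
    breaks (List.replicate k e) = 0 := by
  induction k with
  | zero => rfl
  | succ k ih =>
    cases k with
    | zero => rfl
    | succ k =>
      rw [List.replicate_succ] at ih ⊢
      rw [List.replicate_succ, breaks, ih]
      simp [he]

theorem le_breaks_flatten_replicate (l : List (ZMod m)) (k : ℕ) :
    k * breaks l ≤ breaks (List.replicate k l).flatten := by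
  induction k with
  | zero => simp
  | succ k ih =>
    rw [List.replicate_succ, List.flatten_cons]
    have := (breaks_append l (List.replicate k l).flatten).1
    linarith

/-- A cyclic sequence of exponents without breaks is constant, equal to `1` or to `-1`. -/
theorem eq_replicate_of_breaks_eq_zero {l : List (ZMod m)} (hl : l ≠ [])
    (h : breaks (l ++ l) = 0) : ∃ e : ZMod m, (e = 1 ∨ e = -1) ∧ ∀ e' ∈ l, e' = e := by
  have key : ∀ (r : List (ZMod m)) (e e' : ZMod m), breaks (e :: e' :: r) = 0 →
      (e = 1 ∨ e = -1) ∧ ∀ x ∈ e' :: r, x = e := by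
    intro r
    induction r with
    | nil =>
      intro e e' h
      simp only [breaks] at h
      split_ifs at h with h'
      · exact ⟨h'.2, by simp [h'.1]⟩
      · simp at h
    | cons e'' r ih =>
      intro e e' h
      rw [breaks] at h
      split_ifs at h with h'
      · obtain ⟨rfl, h'⟩ := h'
        have := ih e e'' (by omega)
        exact ⟨h', by simpa using this.2⟩
      · omega
  match l, hl, h with
  | [e], _, h =>
    have := key [] e e h
    exact ⟨e, this.1, by simp⟩
  | e :: e' :: l, _, h =>
    have := key _ e e' h
    refine ⟨e, this.1, fun x hx => ?_⟩
    rcases List.mem_cons.1 hx with rfl | hx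
    · rfl
    · exact this.2 x (List.mem_append_left _ hx)

/-- The number of breaks in the reduced word of an element. -/
noncomputable def breakNumber (q : Hecke m) : ℕ := breaks (exponents (reducedWord q))

/-- New breaks arise only at the two sides of the merged letter. -/
theorem breakNumber_mul_le (q r : Hecke m) :
    breakNumber (q * r) ≤ breakNumber q + breakNumber r + 2 := by
  obtain ⟨p, c, s, h⟩ := (isReduced_reducedWord r).exists_cancel (isReduced_reducedWord q)
  simp only [wordProd_reducedWord] at h
  rcases h with ⟨h1, h2, h3, h4⟩ | ⟨i, x, y, h1, h2, h3, h4⟩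
  · rw [breakNumber, breakNumber, breakNumber, h4, h3.reducedWord_wordProd, h1, h2]
    simp only [exponents_append]
    have k1 := breaks_append (exponents p) (exponents c)
    have k2 := breaks_append (exponents (wordInv c)) (exponents s)
    have k3 := breaks_append (exponents p) (exponents s)
    omega
  · rw [breakNumber, breakNumber, breakNumber, h4, h3.reducedWord_wordProd, h1, h2]
    simp only [exponents_append]
    have k1 := breaks_append (exponents p ++ exponents [⟨i, x⟩]) (exponents c)
    have k2 := breaks_append (exponents (wordInv c) ++ exponents [⟨i, y⟩]) (exponents s)
    have k3 := breaks_append (exponents p) (exponents [⟨i, x⟩])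
    have k4 := breaks_append (exponents (wordInv c)) (exponents [⟨i, y⟩])
    have k5 := breaks_append (exponents p ++ exponents [⟨i, x * y⟩]) (exponents s)
    have k6 := breaks_append (exponents p) (exponents [⟨i, x * y⟩])
    have k7 : breaks (exponents [(⟨i, x * y⟩ : Σ i, Factor m i)]) = 0 := by
      cases i <;> rfl
    omega

open Classical in
/-- The odd function on `ℤ/m` which is `1` at `1`, `-1` at `-1`, and `0` elsewhere. -/
noncomputable def expSign (e : ZMod m) : ℤ := if e = 1 then 1 else if e = -1 then -1 else 0

/-- The sign of the exponent of a letter; it is `0` for the letters of the factor `ℤ/2`. -/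
noncomputable def letterSign : (Σ i, Factor m i) → ℤ
  | ⟨true, e⟩ => expSign (Multiplicative.toAdd e)
  | ⟨false, _⟩ => 0

/-- The sum of the signs of the exponents in the reduced word of an element. -/
noncomputable def signSum (q : Hecke m) : ℤ := ((reducedWord q).map letterSign).sum

theorem one_ne_neg_one (hm : 3 ≤ m) : (1 : ZMod m) ≠ -1 := by
  intro h
  have h2 : ((2 : ℕ) : ZMod m) = 0 := by
    push_cast
    rw [← one_add_one_eq_two]
    nth_rewrite 1 [h]
    exact neg_add_cancel 1
  have := Nat.le_of_dvd (by norm_num) ((ZMod.natCast_eq_zero_iff 2 m).1 h2)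
  omega

theorem one_ne_zero_of_le (hm : 3 ≤ m) : (1 : ZMod m) ≠ 0 := fun h =>
  one_ne_neg_one hm (by rw [h, neg_zero])

theorem expSign_one : expSign (1 : ZMod m) = 1 := by simp [expSign]

theorem expSign_neg_one (hm : 3 ≤ m) : expSign (-1 : ZMod m) = -1 := by
  simp [expSign, (one_ne_neg_one hm).symm]

theorem expSign_neg (hm : 3 ≤ m) (e : ZMod m) : expSign (-e) = -expSign e := by
  by_cases h1 : e = 1
  · rw [h1, expSign_one, expSign_neg_one hm]
  by_cases h2 : e = -1
  · rw [h2, neg_neg, expSign_one, expSign_neg_one hm, neg_neg]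
  · have h3 : -e ≠ 1 := fun h => h2 (by rw [← h, neg_neg])
    have h4 : -e ≠ -1 := fun h => h1 (neg_injective h)
    simp [expSign, h1, h2, h3]

theorem abs_letterSign_le (x : Σ i, Factor m i) : |letterSign x| ≤ 1 := by
  obtain ⟨_ | _, e⟩ := x
  · simp [letterSign]
  · simp only [letterSign, expSign]
    split_ifs <;> simp

theorem abs_signSum_mul_le (hm : 3 ≤ m) (q r : Hecke m) :
    |signSum (q * r) - signSum q - signSum r| ≤ 3 := by
  refine abs_sum_reducedWord_mul_le _ (fun i x => ?_) abs_letterSign_le q r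
  cases i
  · rfl
  · exact expSign_neg hm _

theorem reducedWord_rot_mul_flip_pow {e : ZMod m} (he : e ≠ 0) (k : ℕ) :
    reducedWord ((rot e * flip m) ^ k) =
      (List.replicate k [rotLetter e, flipLetter m]).flatten := by
  have h : IsReduced [rotLetter e, flipLetter m] :=
    (isReduced_append (l := [rotLetter e])).2 ⟨isReduced_singleton (rotLetter_ne_one he),
      isReduced_singleton flipLetter_ne_one, by simp [rotLetter, flipLetter]⟩
  have h' :=
    (isReduced_flatten_replicate h (by simp [rotLetter, flipLetter]) k).reducedWord_wordProd
  rw [wordProd_replicate] at h'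
  simpa [rot, flip] using h'

theorem reducedWord_flip_mul_rot_pow {e : ZMod m} (he : e ≠ 0) (k : ℕ) :
    reducedWord ((flip m * rot e) ^ k) =
      (List.replicate k [flipLetter m, rotLetter e]).flatten := by
  have h : IsReduced [flipLetter m, rotLetter e] :=
    (isReduced_append (l := [flipLetter m])).2 ⟨isReduced_singleton flipLetter_ne_one,
      isReduced_singleton (rotLetter_ne_one he), by simp [rotLetter, flipLetter]⟩
  have h' :=
    (isReduced_flatten_replicate h (by simp [rotLetter, flipLetter]) k).reducedWord_wordProd
  rw [wordProd_replicate] at h'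
  simpa [rot, flip] using h'

theorem signSum_eq (q : Hecke m) :
    signSum q = ((exponents (reducedWord q)).map expSign).sum := by
  rw [signSum]
  induction reducedWord q with
  | nil => rfl
  | cons x l ih =>
    obtain ⟨_ | _, e⟩ := x
    · rw [List.map_cons, List.sum_cons, ih]
      exact zero_add _
    · rw [List.map_cons, List.sum_cons, ih]
      rfl

theorem exponents_rot_mul_flip_pow {e : ZMod m} (he : e ≠ 0) (k : ℕ) :
    exponents (reducedWord ((rot e * flip m) ^ k)) = List.replicate k e := by
  rw [reducedWord_rot_mul_flip_pow he, exponents_replicate]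
  simp

theorem exponents_flip_mul_rot_pow {e : ZMod m} (he : e ≠ 0) (k : ℕ) :
    exponents (reducedWord ((flip m * rot e) ^ k)) = List.replicate k e := by
  rw [reducedWord_flip_mul_rot_pow he, exponents_replicate]
  simp

theorem zpow_rot_mul_flip (hm : 3 ≤ m) (k : ℤ) :
    breakNumber ((rot 1 * flip m) ^ k) = 0 ∧ signSum ((rot 1 * flip m) ^ k) = k := by
  have h0 := one_ne_zero_of_le hm
  obtain ⟨n, rfl | rfl⟩ := k.eq_nat_or_neg
  · rw [zpow_natCast, breakNumber, signSum_eq, exponents_rot_mul_flip_pow h0]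
    simp [breaks_replicate, expSign_one]
  · rw [zpow_neg, zpow_natCast, ← inv_pow, mul_inv_rev, flip_inv, ← rot_neg, breakNumber,
      signSum_eq, exponents_flip_mul_rot_pow (neg_ne_zero.2 h0)]
    simp [breaks_replicate, expSign_neg_one hm]

theorem zpow_flip_mul_rot (hm : 3 ≤ m) (k : ℤ) :
    breakNumber ((flip m * rot 1) ^ k) = 0 ∧ signSum ((flip m * rot 1) ^ k) = k := by
  have h0 := one_ne_zero_of_le hm
  obtain ⟨n, rfl | rfl⟩ := k.eq_nat_or_neg
  · rw [zpow_natCast, breakNumber, signSum_eq, exponents_flip_mul_rot_pow h0]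
    simp [breaks_replicate, expSign_one]
  · rw [zpow_neg, zpow_natCast, ← inv_pow, mul_inv_rev, flip_inv, ← rot_neg, breakNumber,
      signSum_eq, exponents_rot_mul_flip_pow (neg_ne_zero.2 h0)]
    simp [breaks_replicate, expSign_neg_one hm]

theorem signSum_of {i : Bool} (x : Factor m i) : |signSum (CoprodI.of x : Hecke m)| ≤ 1 := by
  rcases eq_or_ne x 1 with rfl | hx
  · have := (isReduced_nil (H := Factor m)).reducedWord_wordProd
    rw [wordProd_nil] at this
    simp [signSum, this]
  · have := (isReduced_singleton (x := (⟨i, x⟩ : Σ i, Factor m i)) hx).reducedWord_wordProd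
    simp only [wordProd_cons, wordProd_nil, mul_one] at this
    simpa [signSum, this] using abs_letterSign_le _

/-- A reduced word that starts with a letter of `ℤ/m`, ends with a letter of `ℤ/2`, and has constant
exponents `e`, is a repetition of one two-letter word. -/
theorem IsReduced.eq_flatten_replicate {e : ZMod m} : ∀ {l : List (Σ i, Factor m i)},
    IsReduced l → (∀ x ∈ l.head?, x.1 = true) → (∀ x ∈ l.getLast?, x.1 = false) →
    (∀ e' ∈ exponents l, e' = e) →
    ∃ n : ℕ, l = (List.replicate n [rotLetter e, flipLetter m]).flatten
  | [], _, _, _, _ => ⟨0, rfl⟩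
  | [x], _, h1, h2, _ => by
    have h1 := h1 x (by simp)
    have h2 := h2 x (by simp)
    simp [h1] at h2
  | ⟨true, x⟩ :: ⟨false, y⟩ :: l, hl, _, h2, h3 => by
    have hl' : IsReduced (⟨false, y⟩ :: l : List (Σ i, Factor m i)) :=
      (isReduced_append (l := [_]).1 hl).2.1
    have hl'' := isReduced_append (l := [(⟨false, y⟩ : Σ i, Factor m i)]).1 hl'
    have hy : y ≠ 1 := hl'.1 ⟨false, y⟩ List.mem_cons_self
    have hx : (⟨true, x⟩ : Σ i, Factor m i) = rotLetter e :=
      congrArg (Sigma.mk true) (h3 (Multiplicative.toAdd x) List.mem_cons_self)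
    obtain ⟨n, hn⟩ := eq_flatten_replicate (l := l) hl''.2.1
      (fun z hz => by simpa using (hl''.2.2 ⟨false, y⟩ (by simp) z hz).symm)
      (fun z hz => h2 z (by
        cases l with
        | nil => simp at hz
        | cons t l => simpa using hz))
      (fun e' he' => h3 e' (List.mem_cons_of_mem _ he'))
    refine ⟨n + 1, ?_⟩
    rw [hx, eq_flipLetter hy, hn, List.replicate_succ]
    rfl
  | ⟨true, x⟩ :: ⟨true, y⟩ :: l, hl, _, _, _ => by
    exact absurd rfl (List.isChain_cons_cons.1 hl.2).1
  | ⟨false, x⟩ :: y :: l, _, h1, _, _ => by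
    have h1 := h1 ⟨false, x⟩ (by simp)
    simp at h1

/-- Every element of `ℤ/2 * ℤ/m` is conjugate into a factor, or conjugate to a power of
`rot 1 * flip m`, or has a conjugate whose powers have reduced words with a linearly growing number
of breaks. -/
theorem Hecke.trichotomy (q : Hecke m) : ∃ h : Hecke m,
    (∃ e : ZMod m, q = h * rot e * h⁻¹) ∨ q = h * flip m * h⁻¹ ∨
    (∃ n : ℤ, q = h * (rot 1 * flip m) ^ n * h⁻¹) ∨
    ∃ r : Hecke m, q = h * r * h⁻¹ ∧ ∀ k : ℕ, k ≤ breakNumber (r ^ (2 * k)) := by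
  have main : ∀ l : List (Σ i, Factor m i), IsReduced l → l ≠ [] →
      (∀ x ∈ l.head?, x.1 = true) → (∀ x ∈ l.getLast?, x.1 = false) → ∃ h : Hecke m,
      (∃ n : ℤ, wordProd l = h * (rot 1 * flip m) ^ n * h⁻¹) ∨
      ∀ k : ℕ, k ≤ breakNumber (wordProd l ^ (2 * k)) := by
    intro l hl hne h1 h2
    by_cases hb : breaks (exponents l ++ exponents l) = 0
    · have hne' : exponents l ≠ [] := by
        match l, hne, h1 with
        | ⟨true, x⟩ :: l, _, _ => exact List.cons_ne_nil (Multiplicative.toAdd x) (exponents l)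
        | ⟨false, x⟩ :: l, _, h1 => simp at h1
      obtain ⟨e, he, he'⟩ := eq_replicate_of_breaks_eq_zero hne' hb
      obtain ⟨n, rfl⟩ := hl.eq_flatten_replicate h1 h2 he'
      rw [wordProd_replicate]
      have : wordProd [rotLetter e, flipLetter m] = rot e * flip m := by
        simp [rot, flip]
      rw [this]
      rcases he with rfl | rfl
      · exact ⟨1, Or.inl ⟨n, by simp⟩⟩
      · refine ⟨flip m, Or.inl ⟨-n, ?_⟩⟩
        rw [rot_neg, zpow_neg, zpow_natCast, ← inv_pow, ← conj_pow]
        congr 1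
        simp [← mul_assoc]
    · refine ⟨1, Or.inr fun k => ?_⟩
      have h3 : ∀ x ∈ l.getLast?, ∀ y ∈ l.head?, x.1 ≠ y.1 := fun x hx y hy => by
        rw [h1 y hy, h2 x hx]; simp
      rw [← wordProd_replicate, breakNumber,
        (isReduced_flatten_replicate hl h3 _).reducedWord_wordProd, exponents_replicate]
      have h4 : (List.replicate (2 * k) (exponents l)).flatten =
          (List.replicate k (exponents l ++ exponents l)).flatten := by
        induction k with
        | zero => simp
        | succ k ih => rw [Nat.mul_succ, List.replicate_succ, List.replicate_succ,
            List.replicate_succ]; simp [ih]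
      rw [h4]
      exact le_trans (Nat.le_mul_of_pos_right k (Nat.pos_of_ne_zero hb))
        (le_breaks_flatten_replicate _ k)
  obtain ⟨h, l, hl, rfl, hc⟩ := exists_cyclically_reduced q
  match l, hl, hc with
  | [], _, _ => exact ⟨h, Or.inl ⟨0, by simp [rot_zero]⟩⟩
  | [⟨true, x⟩], _, _ =>
    exact ⟨h, Or.inl ⟨Multiplicative.toAdd x, by simp [rot, rotLetter]; rfl⟩⟩
  | [⟨false, x⟩], hl, _ =>
    have hx := eq_flipLetter (hl.1 ⟨false, x⟩ (by simp))
    exact ⟨h, Or.inr (Or.inl (by rw [hx]; simp [flip]))⟩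
  | ⟨true, x⟩ :: y :: l, hl, hc =>
    have hc := hc.resolve_left (by simp)
    obtain ⟨h', hh⟩ := main _ hl (by simp) (by simp) (fun z hz => by
      simpa using hc z hz _ rfl)
    rcases hh with ⟨n, hn⟩ | hh
    · exact ⟨h * h', Or.inr (Or.inr (Or.inl ⟨n, by rw [hn]; simp [mul_assoc]⟩))⟩
    · exact ⟨h, Or.inr (Or.inr (Or.inr ⟨_, rfl, hh⟩))⟩
  | ⟨false, x⟩ :: y :: l, hl, hc =>
    have hc := hc.resolve_left (by simp)
    have hsplit := (isReduced_append (l := [(⟨false, x⟩ : Σ i, Factor m i)]).1 hl)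
    have hlast : ∀ z ∈ (y :: l).getLast?, z.1 = true := fun z hz => by
      simpa using hc z (by simpa using hz) _ rfl
    have hhead : ∀ z ∈ (y :: l).head?, z.1 = true := fun z hz => by
      simpa using (hsplit.2.2 ⟨false, x⟩ (by simp) z hz).symm
    have hred : IsReduced (y :: l ++ [⟨false, x⟩]) :=
      isReduced_append.2 ⟨hsplit.2.1, hsplit.1, fun z hz t ht => by
        rw [hlast z hz]
        simp at ht
        subst ht
        simp⟩
    obtain ⟨h', hh⟩ := main _ hred (by simp) (fun z hz => hhead z (by simpa using hz))
      (fun z hz => by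
        rw [List.getLast?_concat] at hz
        simp at hz
        subst hz
        rfl)
    have hconj : wordProd (⟨false, x⟩ :: y :: l) = CoprodI.of x *
        wordProd (y :: l ++ [⟨false, x⟩]) * (CoprodI.of x)⁻¹ := by simp [mul_assoc]
    rcases hh with ⟨n, hn⟩ | hh
    · exact ⟨h * CoprodI.of x * h', Or.inr (Or.inr (Or.inl ⟨n, by
        rw [hconj, hn]; simp [mul_assoc]⟩))⟩
    · exact ⟨h * CoprodI.of x, Or.inr (Or.inr (Or.inr ⟨_, by
        rw [hconj]; simp [mul_assoc], hh⟩))⟩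

end FreeProduct

/-! ### Alternating products and rotations of the plane -/

section Alternating

theorem map_altProd {G H : Type*} [Monoid G] [Monoid H] (f : G →* H) (s t : G) (n : ℕ) :
    f (altProd s t n) = altProd (f s) (f t) n := by
  induction n generalizing s t with
  | zero => exact map_one f
  | succ n ih => rw [altProd, altProd, map_mul, ih]

/-- The alternating products of `u * τ` and `τ * u`, when `τ ^ 2` commutes with `u`. -/
theorem altProd_mul_mul {G : Type*} [Group G] {u τ : G} (h : Commute (τ * τ) u) (n : ℕ) :
    altProd (u * τ) (τ * u) n = u ^ n * τ ^ n ∧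
      altProd (τ * u) (u * τ) n = τ * (u ^ n * τ ^ n) * τ⁻¹ := by
  induction n with
  | zero => simp [altProd]
  | succ n ih =>
    rw [altProd, altProd, ih.1, ih.2]
    constructor
    · calc u * τ * (τ * (u ^ n * τ ^ n) * τ⁻¹) = u * (τ * τ * u ^ n) * τ ^ n * τ⁻¹ := by
            simp only [mul_assoc]
        _ = u * u ^ n * (τ * τ * (τ ^ n * τ⁻¹)) := by
            rw [(h.pow_right n).eq]; simp only [mul_assoc]
        _ = u ^ (n + 1) * τ ^ (n + 1) := by
            rw [← pow_succ', ← zpow_natCast τ, ← zpow_natCast τ, ← zpow_neg_one,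
              ← zpow_add, ← pow_two, ← zpow_natCast τ 2, ← zpow_add]
            congr 2
            push_cast
            ring
    · rw [pow_succ', pow_succ]
      simp [mul_assoc]

theorem altProd_eq_of_commute {G : Type*} [Group G] {u τ : G} {n : ℕ} (h : Commute (τ * τ) u)
    (h' : Commute (u ^ n) τ) : altProd (u * τ) (τ * u) n = altProd (τ * u) (u * τ) n := by
  rw [(altProd_mul_mul h n).1, (altProd_mul_mul h n).2, ← mul_assoc, ← h'.eq, mul_assoc, mul_assoc,
    ← mul_assoc τ, ← pow_succ', pow_succ, mul_inv_cancel_right]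

open Matrix Real

/-- The quarter turn in `SL₂(ℝ)`. -/
def quarterTurn : Matrix.SpecialLinearGroup (Fin 2) ℝ := ⟨!![0, 1; -1, 0], by simp [det_fin_two]⟩

/-- The matrix `!![c, -1; 1, 0]`; for `c = 2 cos (π / m)` it is conjugate to a rotation of angle
`π / m`. -/
def ellipticMatrix (c : ℝ) : Matrix.SpecialLinearGroup (Fin 2) ℝ :=
  ⟨!![c, -1; 1, 0], by simp [det_fin_two]⟩

theorem quarterTurn_mul_self : quarterTurn * quarterTurn = -1 := by
  ext i j
  rw [Matrix.SpecialLinearGroup.coe_mul]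
  fin_cases i <;> fin_cases j <;> simp [quarterTurn]

theorem coe_ellipticMatrix_mul_quarterTurn (c : ℝ) :
    (ellipticMatrix c * quarterTurn : Matrix (Fin 2) (Fin 2) ℝ) = !![1, c; 0, 1] := by
  simp [ellipticMatrix, quarterTurn]

theorem coe_quarterTurn_mul_ellipticMatrix (c : ℝ) :
    (quarterTurn * ellipticMatrix c : Matrix (Fin 2) (Fin 2) ℝ) = !![1, 0; -c, 1] := by
  simp [ellipticMatrix, quarterTurn]

theorem sin_smul_ellipticMatrix_pow (θ : ℝ) (k : ℕ) :
    sin θ • ((ellipticMatrix (2 * cos θ) ^ k : Matrix.SpecialLinearGroup (Fin 2) ℝ) :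
      Matrix (Fin 2) (Fin 2) ℝ) =
      !![sin ((k + 1) * θ), -sin (k * θ); sin (k * θ), -sin ((k - 1) * θ)] := by
  induction k with
  | zero =>
    ext i j
    fin_cases i <;> fin_cases j <;> simp
  | succ k ih =>
    rw [pow_succ, Matrix.SpecialLinearGroup.coe_mul, ← smul_mul_assoc, ih]
    have h1 : sin (((k : ℝ) + 1) * θ) = sin (k * θ) * cos θ + cos (k * θ) * sin θ := by
      rw [← sin_add]; ring_nf
    have h2 : sin (((k : ℝ) - 1) * θ) = sin (k * θ) * cos θ - cos (k * θ) * sin θ := by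
      rw [← sin_sub]; ring_nf
    have h3 : sin (((k : ℝ) + 1 + 1) * θ) =
        sin ((k + 1) * θ) * (2 * cos θ) - sin (k * θ) := by
      have e : ((k : ℝ) + 1 + 1) * θ = (k * θ + θ) + θ := by ring
      have e' : ((k : ℝ) + 1) * θ = k * θ + θ := by ring
      rw [e, e', sin_add (_ + θ), sin_add, cos_add]
      linear_combination -sin (k * θ) * sin_sq_add_cos_sq θ
    ext i j
    fin_cases i <;> fin_cases j <;> simp [ellipticMatrix, h3]
    · ring
    · rw [h1, h2]; ring

theorem ellipticMatrix_pow {m : ℕ} (hm : 2 ≤ m) : ellipticMatrix (2 * cos (π / m)) ^ m = -1 := by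
  have hm' : (2 : ℝ) ≤ m := by exact_mod_cast hm
  have hsin : 0 < sin (π / m) := sin_pos_of_pos_of_lt_pi (by positivity)
    (div_lt_self pi_pos (by linarith))
  have h := sin_smul_ellipticMatrix_pow (π / m) m
  have e0 : (m : ℝ) * (π / m) = π := by field_simp
  have e1 : ((m : ℝ) + 1) * (π / m) = π / m + π := by rw [add_mul, e0]; ring
  have e2 : ((m : ℝ) - 1) * (π / m) = π - π / m := by rw [sub_mul, e0]; ring
  rw [e0, e1, e2, sin_pi, sin_add_pi, sin_pi_sub] at h
  refine Matrix.SpecialLinearGroup.ext _ _ fun i j => ?_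
  have hij := congrFun (congrFun h i) j
  refine mul_left_cancel₀ hsin.ne' ?_
  fin_cases i <;> fin_cases j <;> simpa using hij

theorem altProd_ellipticMatrix {m : ℕ} (hm : 2 ≤ m) :
    altProd (ellipticMatrix (2 * cos (π / m)) * quarterTurn)
      (quarterTurn * ellipticMatrix (2 * cos (π / m))) m =
    altProd (quarterTurn * ellipticMatrix (2 * cos (π / m)))
      (ellipticMatrix (2 * cos (π / m)) * quarterTurn) m := by
  refine altProd_eq_of_commute ?_ ?_
  · rw [quarterTurn_mul_self]; exact Commute.neg_one_left _
  · rw [ellipticMatrix_pow hm]; exact Commute.neg_one_left _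

end Alternating

/-! ### The free product acts faithfully on binary quadratic forms -/

section PingPong

open Matrix Real Monoid
open scoped Pointwise

/-- The action of `SL₂(ℝ)` on `2 × 2` matrices by `S ↦ A S Aᵀ`. -/
def formAction : Matrix.SpecialLinearGroup (Fin 2) ℝ →* Equiv.Perm (Matrix (Fin 2) (Fin 2) ℝ) :=
  MonoidHom.toHomPerm
    { toFun := fun A S => (A : Matrix (Fin 2) (Fin 2) ℝ) * S * (A : Matrix (Fin 2) (Fin 2) ℝ)ᵀ
      map_one' := by funext S; simp; rfl
      map_mul' := fun A B => by
        funext S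
        change _ = (A : Matrix (Fin 2) (Fin 2) ℝ) * (_ * S * _) * _
        simp [transpose_mul, mul_assoc] }

theorem formAction_apply (A : Matrix.SpecialLinearGroup (Fin 2) ℝ) (S : Matrix (Fin 2) (Fin 2) ℝ) :
    formAction A S = (A : Matrix (Fin 2) (Fin 2) ℝ) * S * (A : Matrix (Fin 2) (Fin 2) ℝ)ᵀ := rfl

theorem formAction_vecMulVec (A : Matrix.SpecialLinearGroup (Fin 2) ℝ) (x : Fin 2 → ℝ) :
    formAction A (vecMulVec x x) =
      vecMulVec ((A : Matrix (Fin 2) (Fin 2) ℝ) *ᵥ x) ((A : Matrix (Fin 2) (Fin 2) ℝ) *ᵥ x) := by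
  rw [formAction_apply, mul_vecMulVec, vecMulVec_mul, vecMul_transpose]

theorem formAction_neg_one : formAction (-1) = 1 := by
  ext S : 1
  simp [formAction_apply]

theorem exists_hom_of_pow_eq_one {P : Type*} [Group P] {n : ℕ} {p : P} (hp : p ^ n = 1) :
    ∃ f : Multiplicative (ZMod n) →* P, ∀ k : ℕ, f (Multiplicative.ofAdd (k : ZMod n)) = p ^ k := by
  refine ⟨AddMonoidHom.toMultiplicativeLeft (ZMod.lift n
    ⟨zmultiplesHom (Additive P) (Additive.ofMul p), ?_⟩), fun k => ?_⟩
  · simp [← ofMul_pow, hp]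
  · rw [AddMonoidHom.toMultiplicativeLeft_apply_apply, toAdd_ofAdd, ← Int.cast_natCast (k : ℕ),
      ZMod.lift_coe]
    simp

/-- The ping-pong argument for the action of `ℤ/2 * ℤ/m` on the squares of linear forms: the factor
`ℤ/2` exchanges the forms with coefficients of the same sign and those with coefficients of
opposite signs, and the nontrivial elements of `ℤ/m` map the latter to the former. -/
theorem exists_faithful_action {m : ℕ} (hm : 3 ≤ m) :
    ∃ F : Hecke m →* Equiv.Perm (Matrix (Fin 2) (Fin 2) ℝ), Function.Injective F ∧
      F (rot 1) = formAction (ellipticMatrix (2 * cos (π / m))) ∧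
      F (flip m) = formAction quarterTurn := by
  set u := ellipticMatrix (2 * cos (π / m)) with hu
  have hum : formAction u ^ m = 1 := by
    rw [← map_pow, ellipticMatrix_pow (by omega), formAction_neg_one]
  have hτ : formAction quarterTurn ^ 2 = 1 := by
    rw [← map_pow, pow_two, quarterTurn_mul_self, formAction_neg_one]
  obtain ⟨f₁, hf₁⟩ := exists_hom_of_pow_eq_one hum
  obtain ⟨f₀, hf₀⟩ := exists_hom_of_pow_eq_one hτ
  let f : ∀ i, Factor m i →* Equiv.Perm (Matrix (Fin 2) (Fin 2) ℝ) := fun i =>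
    match i with
    | true => f₁
    | false => f₀
  refine ⟨CoprodI.lift f, ?_, ?_, ?_⟩
  · let X : Bool → Set (Matrix (Fin 2) (Fin 2) ℝ) := fun i =>
      match i with
      | true => {S | ∃ x : Fin 2 → ℝ, 0 < x 0 * x 1 ∧ S = vecMulVec x x}
      | false => {S | ∃ x : Fin 2 → ℝ, x 0 * x 1 < 0 ∧ S = vecMulVec x x}
    have hdisj : Disjoint (X true) (X false) := by
      rw [Set.disjoint_left]
      rintro _ ⟨x, hx, rfl⟩ ⟨y, hy, h⟩
      have := congrFun (congrFun h 0) 1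
      simp only [vecMulVec_apply] at this
      linarith
    have : NeZero m := ⟨by omega⟩
    refine CoprodI.lift_injective_of_ping_pong f (Or.inr ⟨true, ?_⟩) X ?_ ?_ ?_
    · change 3 ≤ Cardinal.mk (ZMod m)
      rw [Cardinal.mk_fintype, ZMod.card]
      exact_mod_cast hm
    · rintro (_ | _)
      · exact ⟨_, ![1, -1], by simp, rfl⟩
      · exact ⟨_, ![1, 1], by simp, rfl⟩
    · rintro (_ | _) (_ | _) hij
      · exact absurd rfl hij
      · exact hdisj.symm
      · exact hdisj
      · exact absurd rfl hij
    · rintro (_ | _) (_ | _) hij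
      · exact absurd rfl hij
      · rintro h hh _ ⟨_, ⟨x, hx, rfl⟩, rfl⟩
        have h1 : h = Multiplicative.ofAdd ((1 : ℕ) : ZMod 2) := by
          have key : ∀ y : ZMod 2, y ≠ 0 → y = ((1 : ℕ) : ZMod 2) := by decide
          exact key h hh
        refine ⟨(quarterTurn : Matrix (Fin 2) (Fin 2) ℝ) *ᵥ x, ?_, ?_⟩
        rotate_left
        · change f₀ h (vecMulVec x x) = _
          rw [h1, hf₀, pow_one, formAction_vecMulVec]
        · simp only [quarterTurn, mulVec, dotProduct, Fin.sum_univ_two]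
          simp
          linarith
      · rintro h hh _ ⟨_, ⟨x, hx, rfl⟩, rfl⟩
        set k := ZMod.val (Multiplicative.toAdd h : ZMod m) with hk
        have h1 : h = Multiplicative.ofAdd (k : ZMod m) := by
          have : (k : ZMod m) = (Multiplicative.toAdd h : ZMod m) := by simp [hk]
          rw [this]
          rfl
        have hk0 : 0 < k := Nat.pos_of_ne_zero fun h0 => hh ((ZMod.val_eq_zero _).1 h0)
        have hkm : k < m := ZMod.val_lt _
        have hm0 : (0 : ℝ) < m := by exact_mod_cast (by omega : 0 < m)
        have hθ : 0 < π / m := by positivity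
        have e0 : (m : ℝ) * (π / m) = π := by field_simp
        have hk0' : (1 : ℝ) ≤ k := by exact_mod_cast hk0
        have hkm' : (k : ℝ) + 1 ≤ m := by exact_mod_cast hkm
        have hs : 0 < sin (π / m) := sin_pos_of_pos_of_lt_pi hθ (by nlinarith)
        have hs0 : 0 < sin (k * (π / m)) := sin_pos_of_pos_of_lt_pi (by positivity) (by nlinarith)
        have hs1 : 0 ≤ sin ((k + 1) * (π / m)) :=
          sin_nonneg_of_nonneg_of_le_pi (by positivity) (by nlinarith)
        have hs2 : 0 ≤ sin ((k - 1) * (π / m)) :=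
          sin_nonneg_of_nonneg_of_le_pi (mul_nonneg (by linarith) hθ.le) (by nlinarith)
        refine ⟨((u ^ k : Matrix.SpecialLinearGroup (Fin 2) ℝ) : Matrix (Fin 2) (Fin 2) ℝ) *ᵥ x,
          ?_, ?_⟩
        rotate_left
        · change f₁ h (vecMulVec x x) = _
          rw [h1, hf₁, ← map_pow, formAction_vecMulVec]
        -- all entries of the power are nonnegative up to the signs in the second column, so that it
        -- maps vectors with coordinates of opposite signs to ones with coordinates of equal signs
        · have hpow := sin_smul_ellipticMatrix_pow (π / m) k
          rw [← hu] at hpow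
          set A := ((u ^ k : Matrix.SpecialLinearGroup (Fin 2) ℝ) : Matrix (Fin 2) (Fin 2) ℝ)
          have hA : sin (π / m) • (A *ᵥ x) =
              ![sin ((k + 1) * (π / m)) * x 0 - sin (k * (π / m)) * x 1,
                sin (k * (π / m)) * x 0 - sin ((k - 1) * (π / m)) * x 1] := by
            rw [← smul_mulVec, hpow]
            ext i
            fin_cases i <;> simp [mulVec, dotProduct, Fin.sum_univ_two] <;> ring
          have h0 := congrFun hA 0
          have h1 := congrFun hA 1
          simp only [Pi.smul_apply, smul_eq_mul, cons_val_zero, cons_val_one] at h0 h1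
          have hpos : 0 < (sin (π / m) * (A *ᵥ x) 0) * (sin (π / m) * (A *ᵥ x) 1) := by
            rw [h0, h1]
            rcases mul_neg_iff.1 hx with ⟨hx0, hx1⟩ | ⟨hx0, hx1⟩
            · exact mul_pos (by nlinarith [mul_nonneg hs1 hx0.le,
                  mul_pos_of_neg_of_neg (neg_neg_of_pos hs0) hx1])
                (by nlinarith [mul_pos hs0 hx0, mul_nonneg hs2 (neg_nonneg.2 hx1.le)])
            · exact mul_pos_of_neg_of_neg
                (by nlinarith [mul_nonneg hs1 (neg_nonneg.2 hx0.le), mul_pos hs0 hx1])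
                (by nlinarith [mul_pos hs0 (neg_pos.2 hx0), mul_nonneg hs2 hx1.le])
          by_contra hneg
          push Not at hneg
          nlinarith [mul_pos hs hs]
      · exact absurd rfl hij
  · rw [rot, CoprodI.lift_of]
    have := hf₁ 1
    rw [Nat.cast_one, pow_one] at this
    exact this
  · rw [flip, CoprodI.lift_of]
    have := hf₀ 1
    rw [Nat.cast_one, pow_one] at this
    exact this

end PingPong

/-! ### The symplectic representation of an Artin group -/

section Representation

open Matrix Real Monoid

variable {V : Type*}

/-- The length homomorphism of an Artin group. -/
theorem exists_length_hom (M : CoxeterMatrix V) :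
    ∃ L : ArtinGroup M →* Multiplicative ℤ, ∀ s, L (gen M s) = Multiplicative.ofAdd 1 := by
  have hrel : ∀ r ∈ artinRelators M,
      FreeGroup.lift (fun _ : V => Multiplicative.ofAdd (1 : ℤ)) r = 1 := by
    rintro r ⟨s, t, -, -, rfl⟩
    rw [map_mul, map_inv, map_altProd, map_altProd, FreeGroup.lift_apply_of,
      FreeGroup.lift_apply_of, mul_inv_cancel]
  exact ⟨PresentedGroup.toGroup hrel, fun s => PresentedGroup.toGroup.of hrel⟩

theorem altProd_gen (M : CoxeterMatrix V) {a b : V} (hab : a ≠ b) (h : M a b ≠ 0) :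
    altProd (gen M a) (gen M b) (M a b) = altProd (gen M b) (gen M a) (M a b) := by
  have := PresentedGroup.one_of_mem (rels := artinRelators M) ⟨a, b, hab, h, rfl⟩
  rw [map_mul, map_inv, map_altProd, map_altProd, mul_inv_eq_one] at this
  exact this

variable [Fintype V]

/-- An alternating form with `ω(s, t) = ± 2 cos (π / m_st)`, and with a positive sign at `(a, b)`.
The signs come from a linear order of the vertices. -/
theorem exists_alternating_form (M : CoxeterMatrix V) {a b : V} (hab : a ≠ b) :
    ∃ w : V → V → ℝ, (∀ s t, w s t = -w t s) ∧ w a b = 2 * cos (π / M a b) ∧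
      ∀ s t, s ≠ t → w s t = 2 * cos (π / M s t) ∨ w t s = 2 * cos (π / M s t) := by
  have : ∃ f : V → ℤ, Function.Injective f ∧ f a < f b := by
    have hf : Function.Injective fun v : V => ((Fintype.equivFin V v : ℕ) : ℤ) := fun x y h =>
      (Fintype.equivFin V).injective (Fin.ext (Int.ofNat_inj.1 h))
    rcases lt_or_gt_of_ne (hf.ne hab) with h | h
    · exact ⟨_, hf, h⟩
    · exact ⟨_, neg_injective.comp hf, neg_lt_neg h⟩
  obtain ⟨f, hf, hfab⟩ := this
  refine ⟨fun s t => if f s < f t then 2 * cos (π / M s t) else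
    if f t < f s then -(2 * cos (π / M s t)) else 0, fun s t => ?_, if_pos hfab, fun s t hst => ?_⟩
  · rcases lt_trichotomy (f s) (f t) with h | h | h
    · simp [h, h.not_gt, M.symmetric s t]
    · simp [h]
    · simp [h, h.not_gt, M.symmetric s t]
  · rcases lt_or_gt_of_ne (hf.ne hst) with h | h
    · simp [h]
    · simp [h, M.symmetric s t]

variable [DecidableEq V]

/-- The transvection `x ↦ x + ω(s, x) e_s` of `ℝ^V`, for an alternating form `ω`. -/
def transvectionUnit {w : V → V → ℝ} (hw : ∀ s t, w s t = -w t s) (s : V) : (Matrix V V ℝ)ˣ :=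
  have h : vecMulVec (Pi.single s 1) (w s) * vecMulVec (Pi.single s 1) (w s) = 0 := by
    have h0 : w s s = 0 := by linarith [hw s s]
    rw [vecMulVec_mul_vecMulVec, dotProduct_single_one, h0, zero_smul, vecMulVec_zero]
  { val := 1 + vecMulVec (Pi.single s 1) (w s)
    inv := 1 - vecMulVec (Pi.single s 1) (w s)
    val_inv := by rw [mul_sub, mul_one, add_mul, one_mul, h, add_zero, add_sub_cancel_right]
    inv_val := by rw [mul_add, mul_one, sub_mul, one_mul, h, sub_zero, sub_add_cancel] }

/-- On the plane spanned by `e_s` and `e_t` the two transvections act by unipotent matrices, and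
they act trivially on a complement. -/
theorem exists_planar_block {w : V → V → ℝ} (hw : ∀ s t, w s t = -w t s) {s t : V}
    (hst : w s t ≠ 0) :
    ∃ j : Matrix.SpecialLinearGroup (Fin 2) ℝ →* (Matrix V V ℝ)ˣ, Function.Injective j ∧
      j (ellipticMatrix (w s t) * quarterTurn) = transvectionUnit hw s ∧
      j (quarterTurn * ellipticMatrix (w s t)) = transvectionUnit hw t := by
  have hs : w s s = 0 := by linarith [hw s s]
  have ht : w t t = 0 := by linarith [hw t t]
  -- the inclusion of the plane, and the projection onto it along its orthogonal complement
  let E : Matrix V (Fin 2) ℝ := Matrix.of fun v i => (![Pi.single s 1, Pi.single t 1] i : V → ℝ) v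
  let E' : Matrix (Fin 2) V ℝ :=
    Matrix.of fun i v => ![-(w t v) / w s t, w s v / w s t] i
  have hE : E' * E = 1 := by
    ext i j
    fin_cases i <;> fin_cases j <;>
      simp [E, E', mul_apply, Pi.single_apply, hs, ht, hw t s, hst]
  have hEr : ∀ X : Matrix (Fin 2) V ℝ, E' * (E * X) = X := fun X => by
    rw [← Matrix.mul_assoc, hE, Matrix.one_mul]
  let j₀ : Matrix (Fin 2) (Fin 2) ℝ →* Matrix V V ℝ :=
    { toFun := fun A => E * A * E' + (1 - E * E')
      map_one' := by simp
      map_mul' := fun A B => by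
        simp only [add_mul, mul_add, sub_mul, mul_sub, Matrix.one_mul, Matrix.mul_one,
          Matrix.mul_assoc, hEr]
        abel }
  have hj₀ : ∀ A : Matrix (Fin 2) (Fin 2) ℝ, E' * j₀ A * E = A := by
    intro A
    change E' * (E * A * E' + (1 - E * E')) * E = A
    simp only [Matrix.add_mul, Matrix.mul_add, Matrix.sub_mul, Matrix.mul_sub, Matrix.mul_one,
      Matrix.mul_assoc, hEr, hE]
    simp
  have hblock : ∀ A : Matrix (Fin 2) (Fin 2) ℝ, j₀ A = 1 + E * (A - 1) * E' := by
    intro A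
    change E * A * E' + (1 - E * E') = _
    rw [Matrix.mul_sub, Matrix.sub_mul, Matrix.mul_one]
    abel
  refine ⟨(Units.map j₀).comp Matrix.SpecialLinearGroup.toGL, ?_, ?_, ?_⟩
  · intro A B h
    have h' : j₀ (A : Matrix (Fin 2) (Fin 2) ℝ) = j₀ (B : Matrix (Fin 2) (Fin 2) ℝ) :=
      congrArg Units.val h
    have h'' := congrArg (fun X => E' * X * E) h'
    simp only [hj₀] at h''
    exact Subtype.ext h''
  · refine Units.ext ?_
    change j₀ ((ellipticMatrix (w s t) * quarterTurn : Matrix.SpecialLinearGroup (Fin 2) ℝ) :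
      Matrix (Fin 2) (Fin 2) ℝ) = 1 + vecMulVec (Pi.single s 1) (w s)
    rw [Matrix.SpecialLinearGroup.coe_mul, coe_ellipticMatrix_mul_quarterTurn, hblock]
    congr 1
    ext x y
    simp [E, E', mul_apply, Fin.sum_univ_two, vecMulVec_apply, one_apply]
    field_simp
  · refine Units.ext ?_
    change j₀ ((quarterTurn * ellipticMatrix (w s t) : Matrix.SpecialLinearGroup (Fin 2) ℝ) :
      Matrix (Fin 2) (Fin 2) ℝ) = 1 + vecMulVec (Pi.single t 1) (w t)
    rw [Matrix.SpecialLinearGroup.coe_mul, coe_quarterTurn_mul_ellipticMatrix, hblock]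
    congr 1
    ext x y
    simp [E, E', mul_apply, Fin.sum_univ_two, vecMulVec_apply, one_apply]
    field_simp

/-- The transvections satisfy the braid relations. For `m = 2` the form vanishes and they commute;
otherwise the relation holds in `SL₂(ℝ)`. -/
theorem altProd_transvectionUnit {w : V → V → ℝ} (hw : ∀ s t, w s t = -w t s) {s t : V} {m : ℕ}
    (hm : 2 ≤ m) (hst : w s t = 2 * cos (π / m)) :
    altProd (transvectionUnit hw s) (transvectionUnit hw t) m =
      altProd (transvectionUnit hw t) (transvectionUnit hw s) m := by
  rcases hm.eq_or_lt with rfl | hm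
  · have h0 : w s t = 0 := by rw [hst]; simp
    have h1 : w t s = 0 := by rw [hw, h0, neg_zero]
    have hc : transvectionUnit hw s * transvectionUnit hw t =
        transvectionUnit hw t * transvectionUnit hw s := by
      refine Units.ext ?_
      change (1 + vecMulVec (Pi.single s 1) (w s)) * (1 + vecMulVec (Pi.single t 1) (w t)) =
        (1 + vecMulVec (Pi.single t 1) (w t)) * (1 + vecMulVec (Pi.single s 1) (w s))
      simp only [add_mul, mul_add, one_mul, mul_one, vecMulVec_mul_vecMulVec,
        dotProduct_single_one, h0, h1, zero_smul, vecMulVec_zero]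
      abel
    simpa [altProd] using hc
  · have hm' : (2 : ℝ) < m := by exact_mod_cast hm
    have hcos : 0 < cos (π / m) := by
      refine cos_pos_of_mem_Ioo ⟨by linarith [pi_pos, show 0 < π / m by positivity], ?_⟩
      exact div_lt_div_of_pos_left pi_pos (by norm_num) hm'
    obtain ⟨j, -, h1, h2⟩ := exists_planar_block hw (s := s) (t := t) (by rw [hst]; positivity)
    rw [← h1, ← h2, ← map_altProd, ← map_altProd, hst, altProd_ellipticMatrix hm.le]

/-- The representation by transvections, and its block for the plane spanned by `e_a` and `e_b`. -/
theorem exists_symplectic_rep (M : CoxeterMatrix V) {a b : V} (hm : 3 ≤ M a b) :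
    ∃ (ρ : ArtinGroup M →* (Matrix V V ℝ)ˣ)
      (j : Matrix.SpecialLinearGroup (Fin 2) ℝ →* (Matrix V V ℝ)ˣ), Function.Injective j ∧
      ρ (gen M a) = j (ellipticMatrix (2 * cos (π / M a b)) * quarterTurn) ∧
      ρ (gen M b) = j (quarterTurn * ellipticMatrix (2 * cos (π / M a b))) := by
  have hab : a ≠ b := by
    rintro rfl
    rw [M.diagonal] at hm
    omega
  obtain ⟨w, hw, hwab, hw'⟩ := exists_alternating_form M hab
  have hm' : (2 : ℝ) < M a b := by exact_mod_cast hm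
  have hcos : 0 < cos (π / M a b) := by
    refine cos_pos_of_mem_Ioo ⟨by linarith [pi_pos, show 0 < π / M a b by positivity], ?_⟩
    exact div_lt_div_of_pos_left pi_pos (by norm_num) hm'
  obtain ⟨j, hj, h1, h2⟩ := exists_planar_block hw (s := a) (t := b) (by rw [hwab]; positivity)
  rw [hwab] at h1 h2
  have hrel : ∀ r ∈ artinRelators M, FreeGroup.lift (transvectionUnit hw) r = 1 := by
    rintro r ⟨s, t, hst, h0, rfl⟩
    have h2 : 2 ≤ M s t := by
      have := M.off_diagonal s t hst
      omega
    rw [map_mul, map_inv, map_altProd, map_altProd, FreeGroup.lift_apply_of,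
      FreeGroup.lift_apply_of, mul_inv_eq_one]
    rcases hw' s t hst with h | h
    · exact altProd_transvectionUnit hw h2 h
    · exact (altProd_transvectionUnit hw h2 h).symm
  refine ⟨PresentedGroup.toGroup hrel, j, hj, ?_, ?_⟩
  · rw [h1]; exact PresentedGroup.toGroup.of hrel
  · rw [h2]; exact PresentedGroup.toGroup.of hrel

/-- The subgroup of the whole Artin group that is generated by `a` and `b` maps to `ℤ/2 * ℤ/m`. -/
theorem exists_hom_hecke (M : CoxeterMatrix V) {a b : V} (hm : 3 ≤ M a b)
    {H : Subgroup (ArtinGroup M)} (hH : H = Subgroup.closure {gen M a, gen M b}) :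
    ∃ ψ : H →* Hecke (M a b), (∀ g : H, (g : ArtinGroup M) = gen M a → ψ g = rot 1 * flip _) ∧
      ∀ g : H, (g : ArtinGroup M) = gen M b → ψ g = flip _ * rot 1 := by
  obtain ⟨ρ, j, hj, ha, hb⟩ := exists_symplectic_rep M hm
  obtain ⟨F, hF, hFr, hFf⟩ := exists_faithful_action hm
  -- the graph of the homomorphism: `ρ` has values in the block `SL₂(ℝ)`, and modulo `± 1` these
  -- values are images of elements of the free product
  let R : ArtinGroup M → Hecke (M a b) → Prop := fun g q => ∃ A, ρ g = j A ∧ F q = formAction A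
  have hRa : R (gen M a) (rot 1 * flip _) := ⟨_, ha, by rw [map_mul, map_mul, hFr, hFf]⟩
  have hRb : R (gen M b) (flip _ * rot 1) := ⟨_, hb, by rw [map_mul, map_mul, hFr, hFf]⟩
  have hRu : ∀ {g q r}, R g q → R g r → q = r := by
    rintro g q r ⟨A, h1, h2⟩ ⟨B, h3, h4⟩
    obtain rfl : A = B := hj (h1.symm.trans h3)
    exact hF (h2.trans h4.symm)
  have hRm : ∀ {g h q r}, R g q → R h r → R (g * h) (q * r) := by
    rintro g h q r ⟨A, h1, h2⟩ ⟨B, h3, h4⟩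
    exact ⟨A * B, by simp [h1, h3], by simp [h2, h4]⟩
  have hex : ∀ g : H, ∃ q, R g q := by
    rintro ⟨g, hg⟩
    subst hH
    induction hg using Subgroup.closure_induction with
    | mem x hx =>
      rcases hx with rfl | rfl
      exacts [⟨_, hRa⟩, ⟨_, hRb⟩]
    | one => exact ⟨1, 1, by simp, by simp⟩
    | mul x y _ _ hx hy =>
      obtain ⟨q, hq⟩ := hx
      obtain ⟨r, hr⟩ := hy
      exact ⟨_, hRm hq hr⟩
    | inv x _ hx =>
      obtain ⟨q, A, h1, h2⟩ := hx
      exact ⟨q⁻¹, A⁻¹, by simp only [map_inv] at h1 ⊢; rw [h1], by simp [h2]⟩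
  choose ψ hψ using hex
  refine ⟨MonoidHom.mk' ψ fun g h => hRu (hψ _) (hRm (hψ g) (hψ h)), fun g hg => ?_, fun g hg => ?_⟩
  · exact hRu (hψ g) (hg ▸ hRa)
  · exact hRu (hψ g) (hg ▸ hRb)

end Representation

/-! ### Garside normal forms in dihedral Artin groups -/

section Garside

open Monoid

variable {G : Type*} [Group G] (s : Bool → G) (m : ℕ)

/-- The alternating product of length `n` that starts with the letter `c`. -/
def alternating (c : Bool) (n : ℕ) : G := altProd (s c) (s !c) n

/-- The Garside element. -/
def garside : G := alternating s false m

/-- The product of alternating words of prescribed lengths, the first of which starts with the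
letter `c`, and each of which starts with the letter with which the preceding one ends. -/
def garsideProd : Bool → List ℕ → G
  | _, [] => 1
  | c, i :: l => alternating s c i * garsideProd (not^[i + 1] c) l

variable {s m}

theorem alternating_succ (c : Bool) (n : ℕ) :
    alternating s c (n + 1) = s c * alternating s (!c) n := by
  rw [alternating, altProd, alternating, Bool.not_not]

theorem alternating_succ' (c : Bool) (n : ℕ) :
    alternating s c (n + 1) = alternating s c n * s (not^[n] c) := by
  induction n generalizing c with
  | zero => simp [alternating, altProd]
  | succ n ih => rw [alternating_succ, ih, alternating_succ, mul_assoc, Function.iterate_succ_apply]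

theorem alternating_eq_garside (hbraid : alternating s false m = alternating s true m)
    (c : Bool) : alternating s c m = garside s m := by
  cases c
  exacts [rfl, hbraid.symm]

/-- Conjugation by the Garside element fixes or exchanges the generators, according to the parity of
`m`. -/
theorem mul_garside (hbraid : alternating s false m = alternating s true m)
    (c : Bool) : s c * garside s m = garside s m * s (not^[m] c) := by
  rw [← alternating_eq_garside hbraid (!c), ← alternating_succ, alternating_succ',
    alternating_eq_garside hbraid, alternating_eq_garside hbraid]

theorem exists_mul_garside_zpow (hbraid : alternating s false m = alternating s true m)
    (c : Bool) (k : ℤ) :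
    ∃ c', s c * garside s m ^ k = garside s m ^ k * s c' := by
  induction k using Int.induction_on with
  | zero => exact ⟨c, by simp⟩
  | succ k ih =>
    obtain ⟨c', h⟩ := ih
    exact ⟨not^[m] c', by rw [zpow_add_one, ← mul_assoc, h, mul_assoc, mul_garside hbraid,
      ← mul_assoc]⟩
  | pred k ih =>
    obtain ⟨c', h⟩ := ih
    refine ⟨not^[m] c', ?_⟩
    have hinv : not^[m] (not^[m] c') = c' := by
      rw [← Function.iterate_add_apply, Bool.involutive_not.iterate_even (Even.add_self m), id]
    have := mul_garside hbraid (not^[m] c')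
    rw [hinv] at this
    rw [zpow_sub_one, ← mul_assoc, h, mul_assoc, mul_assoc, eq_inv_mul_iff_mul_eq.2 this.symm]
    simp [mul_assoc]

theorem exists_mul_garsideProd (hm : 2 ≤ m) (hbraid : alternating s false m = alternating s true m)
    (d c : Bool) {l : List ℕ} (hl : ∀ i ∈ l, 0 < i ∧ i < m) :
    ∃ (k : ℤ) (c' : Bool) (l' : List ℕ), (∀ i ∈ l', 0 < i ∧ i < m) ∧
      s d * garsideProd s c l = garside s m ^ k * garsideProd s c' l' := by
  have h1 : alternating s d 1 = s d := by simp [alternating, altProd]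
  match l, hl with
  | [], _ => exact ⟨0, d, [1], by simp; omega, by simp [garsideProd, h1]⟩
  | i :: l, hl =>
    have hi := hl i List.mem_cons_self
    have hl' : ∀ j ∈ l, 0 < j ∧ j < m := fun j hj => hl j (List.mem_cons_of_mem _ hj)
    by_cases hdc : d = c
    · subst hdc
      refine ⟨0, d, 1 :: i :: l, ?_, ?_⟩
      · intro j hj
        rcases List.mem_cons.1 hj with rfl | hj
        exacts [by omega, hl j hj]
      · simp [garsideProd, h1]
    · obtain rfl : c = !d := by cases c <;> cases d <;> simp_all
      have hstep : s d * garsideProd s (!d) (i :: l) =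
          alternating s d (i + 1) * garsideProd s (not^[i + 1] (!d)) l := by
        rw [garsideProd, ← mul_assoc, ← alternating_succ]
      rcases (Nat.succ_le_iff.2 hi.2).eq_or_lt with him | him
      · refine ⟨1, not^[i + 1] (!d), l, hl', ?_⟩
        rw [hstep, zpow_one, ← alternating_eq_garside hbraid d, ← him]
      · refine ⟨0, d, (i + 1) :: l, ?_, ?_⟩
        · intro j hj
          rcases List.mem_cons.1 hj with rfl | hj
          exacts [⟨by omega, him⟩, hl' j hj]
        · rw [hstep, zpow_zero, one_mul, garsideProd, ← Function.iterate_succ_apply]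

/-- Garside normal form: every element is the product of a power of the Garside element and
of alternating words of lengths less than `m`. -/
theorem exists_garside_form (hm : 2 ≤ m) (hbraid : alternating s false m = alternating s true m)
    (hgen : Subgroup.closure (Set.range s) = ⊤) (g : G) :
    ∃ (k : ℤ) (c : Bool) (l : List ℕ), (∀ i ∈ l, 0 < i ∧ i < m) ∧
      g = garside s m ^ k * garsideProd s c l := by
  let P : G → Prop := fun g => ∃ (k : ℤ) (c : Bool) (l : List ℕ), (∀ i ∈ l, 0 < i ∧ i < m) ∧
      g = garside s m ^ k * garsideProd s c l
  have hgar : ∀ (j : ℤ) (y : G), P y → P (garside s m ^ j * y) := by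
    rintro j y ⟨k, c, l, hl, rfl⟩
    exact ⟨j + k, c, l, hl, by rw [zpow_add, mul_assoc]⟩
  have hs : ∀ (d : Bool) (y : G), P y → P (s d * y) := by
    rintro d y ⟨k, c, l, hl, rfl⟩
    obtain ⟨d', hd⟩ := exists_mul_garside_zpow hbraid d k
    obtain ⟨k', c', l', hl', h⟩ := exists_mul_garsideProd hm hbraid d' c hl
    rw [← mul_assoc, hd, mul_assoc, h]
    exact hgar _ _ ⟨_, _, _, hl', rfl⟩
  have halt : ∀ (n : ℕ) (d : Bool) (y : G), P y → P (alternating s d n * y) := by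
    intro n
    induction n with
    | zero => intro d y hy; simpa [alternating, altProd] using hy
    | succ n ih =>
      intro d y hy
      rw [alternating_succ, mul_assoc]
      exact hs _ _ (ih _ _ hy)
  have hinv : ∀ (d : Bool) (y : G), P y → P ((s d)⁻¹ * y) := by
    intro d y hy
    have h : (s d)⁻¹ = alternating s (!d) (m - 1) * garside s m ^ (-1 : ℤ) := by
      rw [zpow_neg_one, eq_mul_inv_iff_mul_eq, inv_mul_eq_iff_eq_mul, ← alternating_succ,
        Nat.sub_add_cancel (by omega), alternating_eq_garside hbraid]
    rw [h, mul_assoc]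
    exact halt _ _ _ (hgar _ _ hy)
  have hg : g ∈ Subgroup.closure (Set.range s) := hgen ▸ Subgroup.mem_top g
  change P g
  induction hg using Subgroup.closure_induction_left with
  | one => exact ⟨0, true, [], by simp, by simp [garsideProd]⟩
  | mul_left x hx y _ hy =>
    obtain ⟨d, rfl⟩ := hx
    exact hs d y hy
  | inv_mul_cancel x hx y _ hy =>
    obtain ⟨d, rfl⟩ := hx
    exact hinv d y hy

/-- The reduced word of `ℤ/2 * ℤ/m` that a Garside normal form is mapped to. -/
def garsideWord (m : ℕ) (l : List ℕ) : List (Σ i, Factor m i) :=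
  l.flatMap fun i => [rotLetter (i : ZMod m), flipLetter m]

theorem isReduced_garsideWord {l : List ℕ} (hl : ∀ i ∈ l, 0 < i ∧ i < m) :
    IsReduced (garsideWord m l) := by
  induction l with
  | nil => exact isReduced_nil
  | cons i l ih =>
    have hi := hl i List.mem_cons_self
    have hi0 : (i : ZMod m) ≠ 0 := fun h => by
      have := Nat.le_of_dvd hi.1 ((ZMod.natCast_eq_zero_iff i m).1 h)
      omega
    refine isReduced_append.2 ⟨(isReduced_append (l := [_]).2 ⟨isReduced_singleton
      (rotLetter_ne_one hi0), isReduced_singleton flipLetter_ne_one, ?_⟩),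
      ih fun j hj => hl j (List.mem_cons_of_mem _ hj), ?_⟩
    · simp [rotLetter, flipLetter]
    · cases l <;> simp [rotLetter, flipLetter]

theorem flip_pow_iterate_not (c : Bool) (n : ℕ) :
    flip m ^ (not^[n] c).toNat = flip m ^ (n + c.toNat) := by
  induction n generalizing c with
  | zero => simp
  | succ n ih =>
    rw [Function.iterate_succ_apply, ih]
    cases c
    · simp
    · simp [pow_add, mul_assoc]

theorem map_alternating (ψ : G →* Hecke m) (h0 : ψ (s false) = rot 1 * flip m)
    (h1 : ψ (s true) = flip m * rot 1) (c : Bool) (n : ℕ) :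
    ψ (alternating s c n) =
      flip m ^ c.toNat * (rot (n : ZMod m) * flip m ^ n) * flip m ^ c.toNat := by
  have hc : Commute (flip m * flip m) (rot (1 : ZMod m)) := by
    rw [flip_mul_flip]; exact Commute.one_left _
  have hr : rot (n : ZMod m) = rot 1 ^ n := by rw [rot_pow, mul_one]
  rw [alternating, map_altProd, hr]
  cases c
  · simpa [h0, h1] using (altProd_mul_mul hc n).1
  · simpa [h0, h1] using (altProd_mul_mul hc n).2

theorem map_garsideProd (ψ : G →* Hecke m) (h0 : ψ (s false) = rot 1 * flip m)
    (h1 : ψ (s true) = flip m * rot 1) (c : Bool) (l : List ℕ) :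
    ∃ e : ℕ, ψ (garsideProd s c l) =
      flip m ^ c.toNat * wordProd (garsideWord m l) * flip m ^ e := by
  induction l generalizing c with
  | nil => exact ⟨c.toNat, by cases c <;> simp [garsideProd, garsideWord]⟩
  | cons i l ih =>
    obtain ⟨e, he⟩ := ih (not^[i + 1] c)
    refine ⟨e, ?_⟩
    have hf : flip m ^ i * (flip m ^ c.toNat * flip m ^ (i + 1 + c.toNat)) = flip m := by
      rw [← pow_add, ← pow_add,
        show i + (c.toNat + (i + 1 + c.toNat)) = 2 * (i + c.toNat) + 1 by ring,
        pow_succ, pow_mul, pow_two, flip_mul_flip, one_pow, one_mul]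
    have hw : wordProd (garsideWord m (i :: l)) =
        rot (i : ZMod m) * flip m * wordProd (garsideWord m l) := by
      simp [garsideWord, rot, flip, mul_assoc]
    rw [garsideProd, map_mul, map_alternating ψ h0 h1, he, flip_pow_iterate_not, hw]
    calc _ = flip m ^ c.toNat * rot (i : ZMod m) *
          (flip m ^ i * (flip m ^ c.toNat * flip m ^ (i + 1 + c.toNat))) *
          wordProd (garsideWord m l) * flip m ^ e := by simp only [mul_assoc]
      _ = _ := by rw [hf]; simp only [mul_assoc]

/-- A dihedral Artin group embeds into the product of `ℤ/2 * ℤ/m` and `ℤ`: a Garside normal form is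
mapped to a reduced word, up to powers of `flip m`, so that only powers of the Garside element can
be killed in the first factor, and these are detected by their length. -/
theorem eq_one_of_map_eq_one (hm : 2 ≤ m) (hbraid : alternating s false m = alternating s true m)
    (hgen : Subgroup.closure (Set.range s) = ⊤) (ψ : G →* Hecke m)
    (h0 : ψ (s false) = rot 1 * flip m) (h1 : ψ (s true) = flip m * rot 1)
    (L : G →* Multiplicative ℤ) (hL : ∀ c, L (s c) = Multiplicative.ofAdd 1) {g : G}
    (hψg : ψ g = 1) (hLg : L g = 1) : g = 1 := by
  obtain ⟨k, c, l, hl, rfl⟩ := exists_garside_form hm hbraid hgen g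
  have hgar : ψ (garside s m) = flip m ^ m := by
    rw [garside, map_alternating ψ h0 h1]
    simp [rot_zero]
  have hl0 : l = [] := by
    obtain ⟨e, he⟩ := map_garsideProd ψ h0 h1 c l
    rw [map_mul, map_zpow, hgar, he, ← zpow_natCast, ← zpow_natCast, ← zpow_natCast, ← zpow_mul,
      ← mul_assoc, ← mul_assoc, ← zpow_add, mul_eq_one_iff_eq_inv, ← zpow_neg,
      ← eq_inv_mul_iff_mul_eq, ← zpow_neg, ← zpow_add] at hψg
    generalize -(↑m * k + (c.toNat : ℤ)) + -(e : ℤ) = j at hψg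
    have hred := isReduced_garsideWord hl
    have hlen : (garsideWord m l).length = 2 * l.length := by
      simp [garsideWord, List.length_flatMap, mul_comm]
    have hj : flip m ^ j = wordProd [] ∨ flip m ^ j = wordProd [flipLetter m] := by
      have h2 : flip m ^ (2 : ℤ) = 1 := by rw [zpow_ofNat, pow_two, flip_mul_flip]
      rcases Int.even_or_odd' j with ⟨i, rfl | rfl⟩
      · exact Or.inl (by rw [zpow_mul, h2, one_zpow, wordProd_nil])
      · exact Or.inr (by rw [zpow_add, zpow_mul, h2, one_zpow, one_mul, zpow_one]; simp [flip])
    rcases hj with hj | hj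
    · have := congrArg List.length (hred.ext isReduced_nil (hψg.trans hj))
      rw [hlen, List.length_nil] at this
      exact List.length_eq_zero_iff.1 (by omega)
    · have := congrArg List.length (hred.ext (isReduced_singleton flipLetter_ne_one) (hψg.trans hj))
      rw [hlen, List.length_singleton] at this
      omega
  subst hl0
  have hLalt : ∀ (n : ℕ) (d : Bool), L (alternating s d n) = Multiplicative.ofAdd (n : ℤ) := by
    intro n
    induction n with
    | zero => intro d; simp [alternating, altProd]
    | succ n ih =>
      intro d
      rw [alternating_succ, map_mul, hL, ih, ← ofAdd_add]
      congr 1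
      push_cast
      ring
  rw [garsideProd, mul_one, map_zpow, garside, hLalt, ← ofAdd_zsmul, ofAdd_eq_one] at hLg
  have hk : k = 0 := by
    rw [smul_eq_mul, mul_eq_zero] at hLg
    omega
  rw [hk, garsideProd, zpow_zero, mul_one]

end Garside

/-! ### Growth of the syllabic length -/

section Growth

open Monoid

/-- The homomorphism `ℤ/2 * ℤ/m → ℤ/m` that kills `ℤ/2`. -/
def Hecke.toRot (m : ℕ) : Hecke m →* Multiplicative (ZMod m) :=
  CoprodI.lift fun i => match i with
    | true => MonoidHom.id (Multiplicative (ZMod m))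
    | false => (1 : Multiplicative (ZMod 2) →* Multiplicative (ZMod m))

/-- The homomorphism `ℤ/2 * ℤ/m → ℤ/2` that kills `ℤ/m`. -/
def Hecke.toFlip (m : ℕ) : Hecke m →* Multiplicative (ZMod 2) :=
  CoprodI.lift fun i => match i with
    | true => (1 : Multiplicative (ZMod m) →* Multiplicative (ZMod 2))
    | false => MonoidHom.id (Multiplicative (ZMod 2))

variable {m : ℕ}

theorem toRot_rot (e : ZMod m) : Hecke.toRot m (rot e) = Multiplicative.ofAdd e := by
  rw [rot, Hecke.toRot, CoprodI.lift_of]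
  rfl

theorem toRot_flip : Hecke.toRot m (flip m) = 1 := by
  rw [flip, Hecke.toRot, CoprodI.lift_of]
  rfl

theorem toFlip_rot (e : ZMod m) : Hecke.toFlip m (rot e) = 1 := by
  rw [rot, Hecke.toFlip, CoprodI.lift_of]
  rfl

theorem toFlip_flip : Hecke.toFlip m (flip m) = Multiplicative.ofAdd 1 := by
  rw [flip, Hecke.toFlip, CoprodI.lift_of]
  rfl

variable {G : Type*} [Group G] {s : Bool → G} {ψ : G →* Hecke m} {L : G →* Multiplicative ℤ}

theorem toRot_map (hgen : Subgroup.closure (Set.range s) = ⊤)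
    (h0 : ψ (s false) = rot 1 * flip m) (h1 : ψ (s true) = flip m * rot 1)
    (hL : ∀ c, L (s c) = Multiplicative.ofAdd 1) (g : G) :
    Hecke.toRot m (ψ g) = Multiplicative.ofAdd ((Multiplicative.toAdd (L g) : ℤ) : ZMod m) := by
  have : (Hecke.toRot m).comp ψ =
      (AddMonoidHom.toMultiplicative (Int.castAddHom (ZMod m))).comp L := by
    refine MonoidHom.eq_of_eqOn_dense hgen ?_
    rintro _ ⟨c, rfl⟩
    cases c <;> simp [h0, h1, hL, toRot_rot, toRot_flip]
  exact DFunLike.congr_fun this g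

theorem toFlip_map (hgen : Subgroup.closure (Set.range s) = ⊤)
    (h0 : ψ (s false) = rot 1 * flip m) (h1 : ψ (s true) = flip m * rot 1)
    (hL : ∀ c, L (s c) = Multiplicative.ofAdd 1) (g : G) :
    Hecke.toFlip m (ψ g) = Multiplicative.ofAdd ((Multiplicative.toAdd (L g) : ℤ) : ZMod 2) := by
  have : (Hecke.toFlip m).comp ψ =
      (AddMonoidHom.toMultiplicative (Int.castAddHom (ZMod 2))).comp L := by
    refine MonoidHom.eq_of_eqOn_dense hgen ?_
    rintro _ ⟨c, rfl⟩
    cases c <;> simp [h0, h1, hL, toFlip_rot, toFlip_flip]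
  exact DFunLike.congr_fun this g

/-- Every element of `ℤ/2 * ℤ/m` is the image of an element of the dihedral Artin group, up to
the involution `flip m`, which exchanges the images of the two generators. -/
theorem exists_map_eq_or (hm : 3 ≤ m) (h0 : ψ (s false) = rot 1 * flip m)
    (h1 : ψ (s true) = flip m * rot 1) (q : Hecke m) : ∃ g, q = ψ g ∨ q = ψ g * flip m := by
  have : NeZero m := ⟨by omega⟩
  let P : Hecke m → Prop := fun q => ∃ g, q = ψ g ∨ q = ψ g * flip m
  have hflip : ∀ x, P x → P (x * flip m) := by
    rintro x ⟨g, rfl | rfl⟩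
    · exact ⟨g, Or.inr rfl⟩
    · exact ⟨g, Or.inl (by simp [mul_assoc])⟩
  have hrot : ∀ x, P x → P (x * rot 1) := by
    rintro x ⟨g, rfl | rfl⟩
    · exact ⟨g * s false, Or.inr (by simp [h0, mul_assoc])⟩
    · exact ⟨g * s true, Or.inl (by simp [h1, mul_assoc])⟩
  have hof : ∀ (i : Bool) (y : Factor m i) (x : Hecke m), P x → P (x * CoprodI.of y) := by
    rintro (_ | _) y x hx
    · by_cases hy : y = 1
      · simpa [hy] using hx
      · have : (CoprodI.of y : Hecke m) = flip m :=
          congrArg (fun z : Σ i, Factor m i => (CoprodI.of z.2 : Hecke m)) (eq_flipLetter hy)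
        rw [this]
        exact hflip x hx
    · obtain ⟨n, hn⟩ := ZMod.natCast_zmod_surjective (Multiplicative.toAdd y : ZMod m)
      have : (CoprodI.of y : Hecke m) = rot 1 ^ n := by
        rw [rot_pow, mul_one, hn]
        rfl
      rw [this]
      clear this hn
      induction n with
      | zero => simpa using hx
      | succ n ih => rw [pow_succ, ← mul_assoc]; exact hrot _ ih
  have key : ∀ x, P x → P (x * q) := by
    induction q using CoprodI.induction_on with
    | one => intro x hx; simpa using hx
    | of i y => exact hof i y
    | mul q r hq hr => intro x hx; rw [← mul_assoc]; exact hr _ (hq _ hx)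
  have := key 1 ⟨1, Or.inl (map_one ψ).symm⟩
  rwa [one_mul] at this

/-- The number of breaks, and the difference between the length and the sum of signs, are bounded by
multiples of the syllabic length: the former is subadditive up to a bounded error, the latter is
a quasi-morphism, and both vanish on the powers of the generators. -/
theorem invariants_le_syllabicLength (hm : 3 ≤ m) (h0 : ψ (s false) = rot 1 * flip m)
    (h1 : ψ (s true) = flip m * rot 1) (hL : ∀ c, L (s c) = Multiplicative.ofAdd 1)
    (hgen : Subgroup.closure (Set.range s) = ⊤) (g : G) :
    breakNumber (ψ g) ≤ 2 * syllabicLength (Set.range s) g ∧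
      |Multiplicative.toAdd (L g) - signSum (ψ g)| ≤ 3 * syllabicLength (Set.range s) g := by
  have hone : reducedWord (1 : Hecke m) = [] := by
    simpa using (isReduced_nil (H := Factor m)).reducedWord_wordProd
  refine syllables_induction (P := fun g n => breakNumber (ψ g) ≤ 2 * n ∧
    |Multiplicative.toAdd (L g) - signSum (ψ g)| ≤ 3 * n) ?_ ?_ (hgen ▸ Subgroup.mem_top g)
  · simp [breakNumber, signSum, hone, breaks]
  · rintro g - n ⟨hb, hs⟩ _ ⟨c, rfl⟩ k
    have hk : breakNumber (ψ (s c ^ k)) = 0 ∧ signSum (ψ (s c ^ k)) = k := by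
      cases c
      · rw [map_zpow, h0]; exact zpow_rot_mul_flip hm k
      · rw [map_zpow, h1]; exact zpow_flip_mul_rot hm k
    have hb' := breakNumber_mul_le (ψ g) (ψ (s c ^ k))
    have hs' := abs_signSum_mul_le hm (ψ g) (ψ (s c ^ k))
    rw [map_mul, map_mul]
    refine ⟨by omega, ?_⟩
    have hLk : Multiplicative.toAdd (L g * L (s c ^ k)) = Multiplicative.toAdd (L g) + k := by
      rw [toAdd_mul, map_zpow, hL, toAdd_zpow, toAdd_ofAdd, smul_eq_mul, mul_one]
    rw [hLk]
    rw [hk.2] at hs'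
    push_cast
    rw [abs_le] at *
    constructor <;> linarith

theorem exists_le_syllabicLength (hm : 3 ≤ m) (h0 : ψ (s false) = rot 1 * flip m)
    (h1 : ψ (s true) = flip m * rot 1) (hL : ∀ c, L (s c) = Multiplicative.ofAdd 1)
    (hgen : Subgroup.closure (Set.range s) = ⊤) (N : ℕ) :
    ∃ g : G, N < syllabicLength (Set.range s) g := by
  -- powers of `a * b` are mapped to powers of `rot 2`, whose sum of signs is bounded
  refine ⟨(s false * s true) ^ (2 * N + 2), ?_⟩
  have h := (invariants_le_syllabicLength hm h0 h1 hL hgen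
    ((s false * s true) ^ (2 * N + 2))).2
  have hψ : ψ ((s false * s true) ^ (2 * N + 2)) =
      CoprodI.of (rotLetter (((2 * N + 2 : ℕ) : ZMod m) * (1 + 1))).2 := by
    rw [map_pow, map_mul, h0, h1, mul_assoc, ← mul_assoc (flip m), flip_mul_flip, one_mul,
      ← rot_add, rot_pow]
    rfl
  have hs := signSum_of (m := m) (rotLetter (((2 * N + 2 : ℕ) : ZMod m) * (1 + 1))).2
  rw [← hψ] at hs
  have hLg : Multiplicative.toAdd (L ((s false * s true) ^ (2 * N + 2))) = (2 * N + 2) * 2 := by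
    rw [map_pow, map_mul, hL, hL, toAdd_pow, toAdd_mul, toAdd_ofAdd]
    simp
  rw [hLg] at h
  rw [abs_le] at h hs
  omega

/-- The elements of a dihedral Artin group that are neither trivial nor conjugate to a power of
a generator have linearly growing syllabic length. The exceptions occur where the sum of signs
grows at the rate given by the length. -/
theorem exists_linear_lower_bound (hm : 3 ≤ m)
    (hbraid : alternating s false m = alternating s true m)
    (hgen : Subgroup.closure (Set.range s) = ⊤) (h0 : ψ (s false) = rot 1 * flip m)
    (h1 : ψ (s true) = flip m * rot 1) (hL : ∀ c, L (s c) = Multiplicative.ofAdd 1) {g : G}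
    (hg : g ≠ 1) (hconj : ¬ ∃ (h : G) (c : Bool) (k : ℤ), g = h * s c ^ k * h⁻¹) :
    ∃ K C : ℕ, ∀ n : ℕ, n ≤ K * syllabicLength (Set.range s) (g ^ n) + C := by
  have hinj : ∀ {x y : G}, ψ x = ψ y → L x = L y → x = y := fun {x y} hx hy => by
    rw [← mul_inv_eq_one]
    exact eq_one_of_map_eq_one (by omega) hbraid hgen ψ h0 h1 L hL (by simp [hx]) (by simp [hy])
  set ℓ : ℤ := Multiplicative.toAdd (L g) with hℓ
  have hLn : ∀ n : ℕ, Multiplicative.toAdd (L (g ^ n)) = n * ℓ := fun n => by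
    rw [map_pow, toAdd_pow, nsmul_eq_mul]
  have hinv := fun n : ℕ => invariants_le_syllabicLength hm h0 h1 hL hgen (g ^ n)
  -- it suffices that the sums of signs of the powers grow at a rate `t` other than the length `ℓ`
  have hquasi : ∀ (h r : Hecke m) (t D : ℤ), ψ g = h * r * h⁻¹ → t ≠ ℓ →
      (∀ n : ℕ, |signSum (r ^ n) - n * t| ≤ D) →
      ∃ K C : ℕ, ∀ n : ℕ, n ≤ K * syllabicLength (Set.range s) (g ^ n) + C := by
    intro h r t D hgr ht hr
    refine ⟨3, (D + |signSum h| + |signSum h⁻¹| + 6).toNat, fun n => ?_⟩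
    have e1 := abs_signSum_mul_le hm (h * r ^ n) h⁻¹
    have e2 := abs_signSum_mul_le hm h (r ^ n)
    have e3 := (hinv n).2
    have e4 := hr n
    rw [hLn, map_pow, hgr, conj_pow] at e3
    have e5 : (n : ℤ) ≤ |n * (ℓ - t)| := by
      rw [abs_mul, Nat.abs_cast]
      exact le_mul_of_one_le_right (Int.natCast_nonneg n)
        (Int.one_le_abs (sub_ne_zero.2 (Ne.symm ht)))
    have e6 := le_abs_self (signSum h)
    have e7 := le_abs_self (signSum h⁻¹)
    have e8 := neg_abs_le (signSum h)
    have e9 := neg_abs_le (signSum h⁻¹)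
    have e10 : |n * (ℓ - t)| ≤ 3 * syllabicLength (Set.range s) (g ^ n) +
        (D + |signSum h| + |signSum h⁻¹| + 6) := by
      rw [mul_sub]
      rw [abs_le] at e1 e2 e3 e4 ⊢
      constructor <;> linarith
    omega
  obtain ⟨h, ⟨e, he⟩ | hf | ⟨k, hk⟩ | ⟨r, hr, hrk⟩⟩ := Hecke.trichotomy (ψ g)
  -- the length modulo `m` is the total exponent of `rot 1`
  · by_cases hℓ0 : ℓ = 0
    · have := toRot_map hgen h0 h1 hL g
      rw [he, map_mul, map_mul, map_inv, mul_comm, inv_mul_cancel_left, toRot_rot, ← hℓ, hℓ0,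
        Int.cast_zero] at this
      have he0 : e = 0 := Multiplicative.ofAdd.injective this
      refine absurd (hinj ?_ ?_) hg
      · rw [he, he0, rot_zero, map_one]; simp
      · rw [map_one]; exact hℓ0
    · refine hquasi h _ 0 1 he (Ne.symm hℓ0) fun n => ?_
      rw [rot_pow, mul_zero, sub_zero]
      exact signSum_of _
  -- the length modulo `2` is the number of letters `flip m`
  · by_cases hℓ0 : ℓ = 0
    · have := toFlip_map hgen h0 h1 hL g
      rw [hf, map_mul, map_mul, map_inv, mul_comm, inv_mul_cancel_left, toFlip_flip, ← hℓ, hℓ0,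
        Int.cast_zero] at this
      exact absurd (Multiplicative.ofAdd.injective this) (by decide)
    · refine hquasi h _ 0 1 hf (Ne.symm hℓ0) fun n => ?_
      rw [flip, ← map_pow, mul_zero, sub_zero]
      exact signSum_of _
  · by_cases hℓk : k = ℓ
    · refine absurd ?_ hconj
      have hLs : ∀ (x : G) (c : Bool), L (x * s c ^ k * x⁻¹) = L g := fun x c => by
        rw [map_mul, map_mul, map_inv, mul_comm, inv_mul_cancel_left, map_zpow, hL,
          ← ofAdd_zsmul, hℓk]
        simp [hℓ]
      obtain ⟨x, rfl | rfl⟩ := exists_map_eq_or hm h0 h1 h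
      · exact ⟨x, false, k, hinj (by rw [hk]; simp [h0]) (hLs x false).symm⟩
      · refine ⟨x, true, k, hinj ?_ (hLs x true).symm⟩
        rw [hk, map_mul, map_mul, map_zpow, h1, map_inv]
        have : flip m * rot 1 = flip m * (rot 1 * flip m) * (flip m)⁻¹ := by simp [mul_assoc]
        rw [this, conj_zpow]
        simp [mul_assoc]
    · refine hquasi h _ k 0 hk hℓk fun n => ?_
      rw [← zpow_natCast, ← zpow_mul, (zpow_rot_mul_flip hm _).2, mul_comm, sub_self, abs_zero]
  · refine ⟨4, 2 * (breakNumber h⁻¹ + breakNumber h + 4) + 2, fun n => ?_⟩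
    have e1 := hrk n
    rw [two_mul, pow_add] at e1
    have e2 := breakNumber_mul_le (r ^ n) (r ^ n)
    have e3 : r ^ n = h⁻¹ * ψ (g ^ n) * h := by rw [map_pow, hr, conj_pow]; simp [mul_assoc]
    have e4 := breakNumber_mul_le (h⁻¹ * ψ (g ^ n)) h
    have e5 := breakNumber_mul_le h⁻¹ (ψ (g ^ n))
    rw [← e3] at e4
    have e6 := (hinv n).1
    omega

end Growth

/-! ### The rank two parabolic subgroups of an Artin group -/

section RankTwo

theorem syllabicLength_map {G G' : Type*} [Group G] [Group G'] {f : G →* G'}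
    (hf : Function.Injective f) {S : Set G} {g : G} (hg : g ∈ Subgroup.closure S) :
    syllabicLength (f '' S) (f g) = syllabicLength S g := by
  apply le_antisymm
  · obtain ⟨w, hw, rfl, hl⟩ := exists_syllables hg
    rw [← hl]
    have := syllabicLength_le (S := f '' S) (w.map fun p => (f p.1, p.2)) (by
      simp only [List.mem_map, forall_exists_index, and_imp]
      rintro _ p hp rfl
      exact ⟨p.1, hw p hp, rfl⟩)
    have hcomp : (fun p : G' × ℤ => p.1 ^ p.2) ∘ (fun p : G × ℤ => (f p.1, p.2)) =
        f ∘ fun p : G × ℤ => p.1 ^ p.2 := by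
      ext p
      simp
    rw [List.map_map, List.length_map, hcomp] at this
    rwa [map_list_prod, List.map_map]
  · have hg' : f g ∈ Subgroup.closure (f '' S) := by
      rw [← MonoidHom.map_closure]
      exact Subgroup.mem_map_of_mem f hg
    obtain ⟨w', hw', hprod, hl⟩ := exists_syllables hg'
    have lift : ∃ w : List (G × ℤ), (∀ p ∈ w, p.1 ∈ S) ∧ w.length = w'.length ∧
        f (w.map fun p => p.1 ^ p.2).prod = (w'.map fun p => p.1 ^ p.2).prod := by
      clear hprod hl
      induction w' with
      | nil => exact ⟨[], by simp⟩
      | cons p w' ih =>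
        obtain ⟨w, h1, h2, h3⟩ := ih fun q hq => hw' q (List.mem_cons_of_mem _ hq)
        obtain ⟨x, hx, hxp⟩ := hw' p List.mem_cons_self
        refine ⟨(x, p.2) :: w, ?_, by simp [h2], by simp [h3, hxp]⟩
        intro q hq
        rcases List.mem_cons.1 hq with rfl | hq
        exacts [hx, h1 q hq]
    obtain ⟨w, h1, h2, h3⟩ := lift
    rw [hprod] at h3
    rw [← hl, ← h2, ← hf h3]
    exact syllabicLength_le w h1

variable {V : Type*} [Fintype V] [DecidableEq V] (M : CoxeterMatrix V) {a b : V}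
  {H : Subgroup (ArtinGroup M)}

/-- The generators of a rank two parabolic subgroup, the homomorphism of this subgroup to
`ℤ/2 * ℤ/m`, and its length homomorphism. -/
theorem exists_dihedral_data (hm : 3 ≤ M a b) (hH : H = Subgroup.closure {gen M a, gen M b}) :
    ∃ (s : Bool → H) (ψ : H →* Hecke (M a b)) (L : H →* Multiplicative ℤ),
      (s false : ArtinGroup M) = gen M a ∧ (s true : ArtinGroup M) = gen M b ∧
      H.subtype '' Set.range s = {gen M a, gen M b} ∧ Subgroup.closure (Set.range s) = ⊤ ∧
      alternating s false (M a b) = alternating s true (M a b) ∧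
      ψ (s false) = rot 1 * flip _ ∧ ψ (s true) = flip _ * rot 1 ∧
      ∀ c, L (s c) = Multiplicative.ofAdd 1 := by
  have hab : a ≠ b := by
    rintro rfl
    rw [M.diagonal] at hm
    omega
  have ha : gen M a ∈ H := hH ▸ Subgroup.subset_closure (by simp)
  have hb : gen M b ∈ H := hH ▸ Subgroup.subset_closure (by simp)
  obtain ⟨ψ, hψa, hψb⟩ := exists_hom_hecke M hm hH
  obtain ⟨L, hL⟩ := exists_length_hom M
  let s : Bool → H := fun c => match c with
    | false => ⟨gen M a, ha⟩
    | true => ⟨gen M b, hb⟩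
  have himage : H.subtype '' Set.range s = {gen M a, gen M b} := by
    rw [← Set.range_comp]
    ext x
    simp [s]
  refine ⟨s, ψ, L.comp H.subtype, rfl, rfl, himage, ?_, ?_, hψa _ rfl, hψb _ rfl, ?_⟩
  · refine Subgroup.map_injective H.subtype_injective ?_
    rw [MonoidHom.map_closure, himage, ← hH, ← MonoidHom.range_eq_map, Subgroup.range_subtype]
  · refine H.subtype_injective ?_
    rw [alternating, alternating, map_altProd, map_altProd]
    exact altProd_gen M hab (by omega)
  · rintro (_ | _)
    exacts [hL a, hL b]

theorem exists_lt_syllabicLength (hm : 3 ≤ M a b)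
    (hH : H = Subgroup.closure {gen M a, gen M b}) (N : ℕ) :
    ∃ g : H, N < syllabicLength {gen M a, gen M b} (g : ArtinGroup M) := by
  obtain ⟨s, ψ, L, -, -, himage, hgen, -, h0, h1, hL⟩ := exists_dihedral_data M hm hH
  obtain ⟨g, hg⟩ := exists_le_syllabicLength hm h0 h1 hL hgen N
  refine ⟨g, ?_⟩
  rwa [← himage, ← Subgroup.coe_subtype,
    syllabicLength_map H.subtype_injective (hgen ▸ Subgroup.mem_top g)]

theorem syllabicLength_linear_lower_bound (hm : 3 ≤ M a b)
    (hH : H = Subgroup.closure {gen M a, gen M b}) {g : H} (hg : g ≠ 1)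
    (hconj : ¬ ∃ h : H, ∃ s ∈ ({a, b} : Set V), ∃ k : ℤ,
      (g : ArtinGroup M) = h * gen M s ^ k * (h : ArtinGroup M)⁻¹) :
    ∃ K C : ℕ, ∀ n : ℕ,
      n ≤ K * syllabicLength {gen M a, gen M b} ((g : ArtinGroup M) ^ n) + C := by
  obtain ⟨s, ψ, L, hs0, hs1, himage, hgen, hbraid, h0, h1, hL⟩ := exists_dihedral_data M hm hH
  obtain ⟨K, C, h⟩ := exists_linear_lower_bound hm hbraid hgen h0 h1 hL hg (by
    rintro ⟨h, c, k, rfl⟩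
    refine hconj ⟨h, ?_⟩
    cases c
    · exact ⟨a, by simp, k, by simp [hs0]⟩
    · exact ⟨b, by simp, k, by simp [hs1]⟩)
  refine ⟨K, C, fun n => ?_⟩
  rw [← himage, ← Subgroup.coe_pow, ← Subgroup.coe_subtype,
    syllabicLength_map H.subtype_injective (hgen ▸ Subgroup.mem_top _)]
  exact h n

theorem syllabicLength_pow_conj_le {G : Type*} [Group G] {S : Set G} {h s : G}
    (hh : h ∈ Subgroup.closure S) (hs : s ∈ S) (k : ℤ) (n : ℕ) :
    syllabicLength S ((h * s ^ k * h⁻¹) ^ n) ≤ syllabicLength S h + 1 + syllabicLength S h⁻¹ := by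
  have hs' := Subgroup.subset_closure hs
  rw [conj_pow, ← zpow_natCast, ← zpow_mul]
  have e1 := syllabicLength_mul_le (mul_mem hh (zpow_mem hs' (k * n))) (inv_mem hh)
  have e2 := syllabicLength_mul_le hh (zpow_mem hs' (k * n))
  have e3 := syllabicLength_zpow_le hs (k * n)
  omega

end RankTwo

/-! ### The link of a vertex of type `{a, b}` -/

section Link

variable {V : Type*} (M : CoxeterMatrix V)

/-- The vertex `g v_∅` of the Deligne complex. -/
def emptyVertex (g : ArtinGroup M) : DVertex M := ⟨⟨∅, by simp⟩, (g : ArtinGroup M ⧸ _)⟩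

/-- The vertex `g v_c` of the Deligne complex. -/
def singletonVertex (c : V) (g : ArtinGroup M) : DVertex M :=
  ⟨⟨{c}, by simp⟩, (g : ArtinGroup M ⧸ _)⟩

variable {M}

theorem emptyVertex_ne_singletonVertex (c : V) (g h : ArtinGroup M) :
    emptyVertex M g ≠ singletonVertex M c h := by
  intro he
  have := congrArg (fun u : DVertex M => u.1.1) he
  simp [emptyVertex, singletonVertex] at this

theorem out_emptyVertex (g : ArtinGroup M) : (emptyVertex M g).2.out = g := by
  have h := QuotientGroup.mk_out_eq_mul (localGroup M (emptyVertex M g).1) g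
  obtain ⟨⟨x, hx⟩, h⟩ := h
  have hx1 : x = 1 := by simpa [localGroup, emptyVertex] using hx
  subst hx1
  rw [mul_one] at h
  exact h

theorem exists_out_singletonVertex (c : V) (g : ArtinGroup M) :
    ∃ k : ℤ, (singletonVertex M c g).2.out = g * gen M c ^ k := by
  have h := QuotientGroup.mk_out_eq_mul (localGroup M (singletonVertex M c g).1) g
  obtain ⟨⟨x, hx⟩, h⟩ := h
  have : ∃ k : ℤ, gen M c ^ k = x := by
    simpa [localGroup, singletonVertex, Subgroup.mem_closure_singleton] using hx
  obtain ⟨k, rfl⟩ := this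
  exact ⟨k, h⟩

theorem singletonVertex_mul_zpow (c : V) (g : ArtinGroup M) (k : ℤ) :
    singletonVertex M c (g * gen M c ^ k) = singletonVertex M c g := by
  refine congrArg (Sigma.mk _) (QuotientGroup.eq.2 ?_)
  rw [mul_inv_rev, inv_mul_cancel_right]
  exact inv_mem (zpow_mem (show gen M c ∈ localGroup M _ from
    Subgroup.subset_closure (Set.mem_image_of_mem _
      (Finset.mem_coe.2 (Finset.mem_singleton_self c)))) k)

/-- The edge of the Deligne complex with ends `g v_∅` and `g v_c`. -/
def linkEdge (c : V) (g : ArtinGroup M) : Finset (DVertex M) :=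
  Finset.cons (emptyVertex M g) {singletonVertex M c g}
    (by simpa using emptyVertex_ne_singletonVertex c g g)

theorem mem_linkEdge {c : V} {g : ArtinGroup M} {u : DVertex M} :
    u ∈ linkEdge c g ↔ u = emptyVertex M g ∨ u = singletonVertex M c g := by
  simp [linkEdge]

variable [DecidableEq V] {a b : V} (hab : M a b ≠ 0)

theorem localGroup_pairVertex :
    localGroup M (pairVertex M a b hab) = Subgroup.closure {gen M a, gen M b} := by
  simp [localGroup, pairVertex, Set.image_insert_eq]


theorem edge_mem_link (hne : a ≠ b) {g : ArtinGroup M}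
    (hg : g ∈ localGroup M (pairVertex M a b hab))
    {c : V} (hc : c ∈ ({a, b} : Set V)) :
    linkEdge c g ∈ (link M (baseVertex M (pairVertex M a b hab))).faces := by
  have hbase : baseVertex M (pairVertex M a b hab) =
      ⟨pairVertex M a b hab, (g : ArtinGroup M ⧸ _)⟩ :=
    congrArg (Sigma.mk _) (QuotientGroup.eq.2 (by simpa using hg))
  have hcard : ({a, b} : Finset V).card = 2 := Finset.card_pair hne
  have hcs : ({c} : Finset V) ⊆ {a, b} := by
    simpa [Finset.subset_iff] using hc
  have hv : baseVertex M (pairVertex M a b hab) ∉ linkEdge c g := by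
    intro h
    rcases mem_linkEdge.1 h with h | h
    · have := congrArg (fun u : DVertex M => u.1.1.card) h
      simp [emptyVertex, baseVertex, pairVertex, hcard] at this
    · have := congrArg (fun u : DVertex M => u.1.1.card) h
      simp [singletonVertex, baseVertex, pairVertex, hcard] at this
  have key : Finset.cons _ _ hv ∈ (deligneComplex M).faces := by
    refine ⟨Finset.cons_nonempty _, g, ?_, ?_⟩
    · intro u hu
      rcases Finset.mem_cons.1 hu with hu | hu
      · obtain rfl := hu.trans hbase
        rfl
      rcases mem_linkEdge.1 hu with rfl | rfl <;> rfl
    · intro u hu w hw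
      rw [Finset.mem_cons, mem_linkEdge] at hu hw
      rcases hu with rfl | rfl | rfl <;> rcases hw with rfl | rfl | rfl <;>
        first
        | exact Or.inl subset_rfl
        | exact Or.inl (Finset.empty_subset _)
        | exact Or.inr (Finset.empty_subset _)
        | exact Or.inl hcs
        | exact Or.inr hcs
  exact ⟨((deligneComplex M).isRelLowerSet_faces key).2 (Finset.subset_cons _)
    ⟨_, mem_linkEdge.2 (Or.inl rfl)⟩, hv, _, key, Finset.mem_cons_self _ _, Finset.subset_cons _⟩

theorem exists_edge_of_mem_link (hne : a ≠ b) {s : Finset (DVertex M)}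
    (hs : s ∈ (link M (baseVertex M (pairVertex M a b hab))).faces) :
    ∃ g ∈ localGroup M (pairVertex M a b hab), ∃ c ∈ ({a, b} : Set V),
      s ⊆ linkEdge c g := by
  obtain ⟨-, hv, t, ⟨-, g, ht, ht'⟩, hvt, hst⟩ := hs
  have hg : g ∈ localGroup M (pairVertex M a b hab) := by
    have := ht _ hvt
    simpa using QuotientGroup.eq.1 (show ((1 : ArtinGroup M) : ArtinGroup M ⧸
      localGroup M (pairVertex M a b hab)) = (g : ArtinGroup M ⧸ _) from this)
  have hvert : ∀ u ∈ s, u = emptyVertex M g ∨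
      ∃ c ∈ ({a, b} : Set V), u = singletonVertex M c g := by
    intro u hu
    have h2 := ht u (hst hu)
    have h3 := ht' u (hst hu) _ hvt
    have h4 : u ≠ baseVertex M (pairVertex M a b hab) := fun h => hv (h ▸ hu)
    obtain ⟨⟨σ, hσ⟩, q⟩ := u
    obtain rfl : q = (g : ArtinGroup M ⧸ _) := h2
    change σ ⊆ {a, b} ∨ {a, b} ⊆ σ at h3
    have h5 : σ ≠ {a, b} := by
      rintro rfl
      have hg' : g⁻¹ * 1 ∈ localGroup M (pairVertex M a b hab) := by simpa using hg
      exact h4 (congrArg (Sigma.mk (pairVertex M a b hab)) (QuotientGroup.eq.2 hg'))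
    have h6 : σ ⊂ {a, b} := by
      rcases h3 with h3 | h3
      · exact lt_of_le_of_ne h3 h5
      · exact absurd (Finset.eq_of_subset_of_card_le h3
          (by rw [Finset.card_pair hne]; exact hσ.1)).symm h5
    have h7 : σ.card ≤ 1 := by
      have := Finset.card_lt_card h6
      rw [Finset.card_pair hne] at this
      omega
    rcases σ.eq_empty_or_nonempty with rfl | ⟨c, hc⟩
    · exact Or.inl rfl
    · obtain rfl : σ = {c} := by
        refine Finset.eq_singleton_iff_unique_mem.2 ⟨hc, fun x hx => ?_⟩
        exact Finset.card_le_one.1 h7 x hx c hc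
      exact Or.inr ⟨c, by simpa using h6.1 hc, rfl⟩
  by_cases hex : ∃ c ∈ ({a, b} : Set V), singletonVertex M c g ∈ s
  · obtain ⟨c, hc, hcs⟩ := hex
    refine ⟨g, hg, c, hc, fun u hu => ?_⟩
    rcases hvert u hu with rfl | ⟨d, -, rfl⟩
    · exact mem_linkEdge.2 (Or.inl rfl)
    · have : d = c := by
        have := ht' _ (hst hu) _ (hst hcs)
        simpa [singletonVertex, eq_comm] using this
      exact mem_linkEdge.2 (Or.inr (by rw [this]))
  · refine ⟨g, hg, a, by simp, fun u hu => ?_⟩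
    rcases hvert u hu with rfl | ⟨d, hd, rfl⟩
    · exact mem_linkEdge.2 (Or.inl rfl)
    · exact absurd ⟨d, hd, hu⟩ hex

theorem angle_pairVertex (hm : 3 ≤ M a b) {g : ArtinGroup M} {c : V} (hc : c ∈ ({a, b} : Set V))
    {u w : DVertex M} (hu : u ∈ linkEdge c g)
    (hw : w ∈ linkEdge c g) :
    angle M (baseVertex M (pairVertex M a b hab)) u w = Real.pi / (2 * M a b) := by
  have hne : a ≠ b := by
    rintro rfl
    rw [M.diagonal] at hm
    omega
  have hsub : ∀ x ∈ linkEdge c g,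
      x.1.1 ⊆ {a, b} := by
    intro x hx
    rcases mem_linkEdge.1 hx with rfl | rfl
    · exact Finset.empty_subset _
    · simpa [singletonVertex, Finset.subset_iff] using hc
  have hunion : ({a, b} : Finset V) ∪ u.1.1 ∪ w.1.1 = {a, b} := by
    rw [Finset.union_eq_left.2 (hsub u hu), Finset.union_eq_left.2 (hsub w hw)]
  have hcoeff : coeff M {a, b} = M a b := by
    have h1 : (1 : ℕ) ≤ M a b := by omega
    simp [coeff, M.symmetric b a, h1]
  have hcard : (baseVertex M (pairVertex M a b hab)).1.1.card = 2 := Finset.card_pair hne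
  have hset : (baseVertex M (pairVertex M a b hab)).1.1 = {a, b} := rfl
  rw [angle, hcard, hset, hunion, hcoeff]
  rfl

end Link

/-! ### The angular metric and the syllabic length -/

section Metric

variable {V : Type*} {M : CoxeterMatrix V}

theorem LinkPoint.sum_eq {v : DVertex M} (x : LinkPoint M v) {s : Finset (DVertex M)}
    (hs : x.coord.support ⊆ s) : ∑ u ∈ s, x.coord u = 1 := by
  rw [← x.sum_eq_one, Finsupp.sum_of_support_subset _ hs _ (by simp)]

theorem LinkPoint.coord_le_one {v : DVertex M} (x : LinkPoint M v) (u : DVertex M) :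
    x.coord u ≤ 1 := by
  by_cases hu : u ∈ x.coord.support
  · rw [← x.sum_eq subset_rfl]
    exact Finset.single_le_sum (fun w _ => x.nonneg w) hu
  · rw [Finsupp.notMem_support_iff.1 hu]
    exact zero_le_one

/-- A vertex of the link as a point. -/
noncomputable def vertexPoint {v : DVertex M} (u : DVertex M) (hu : {u} ∈ (link M v).faces) :
    LinkPoint M v where
  coord := Finsupp.single u 1
  nonneg w := by
    classical
    rw [Finsupp.single_apply]
    split_ifs <;> norm_num
  sum_eq_one := by simp
  support_mem := by rwa [Finsupp.support_single _ one_ne_zero]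

theorem support_vertexPoint {v u : DVertex M} (hu : {u} ∈ (link M v).faces) :
    (vertexPoint u hu).coord.support = {u} := Finsupp.support_single _ one_ne_zero

variable [DecidableEq V]

theorem edist_le_of_isString {v : DVertex M} {x y : LinkPoint M v} {L : ℝ}
    (h : IsString M v x y L) : edist x y ≤ ENNReal.ofReal L :=
  iInf₂_le L h

theorem edist_smul_le {σ : KVertex M} (h : localGroup M σ) (x y : LinkPoint M (baseVertex M σ)) :
    edist (h • x) (h • y) ≤ edist x y := by
  have harc : ∀ {x y : LinkPoint M (baseVertex M σ)} {d : ℝ},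
      ArcStep M (baseVertex M σ) x y d → ArcStep M (baseVertex M σ) (h • x) (h • y) d := by
    rintro x y d ⟨s, hs, u, w, he, hx, hy, rfl⟩
    have hstab : (h : ArtinGroup M) • baseVertex M σ = baseVertex M σ := by
      rw [← MulAction.mem_stabilizer_iff, stabilizer_baseVertex]
      exact h.2
    have hsupp : ∀ z : LinkPoint M (baseVertex M σ), z.coord.support ⊆ s →
        (h • z).coord.support ⊆ s.map (MulAction.toPerm (h : ArtinGroup M)).toEmbedding := by
      intro z hz
      change (z.coord.equivMapDomain (MulAction.toPerm (h : ArtinGroup M))).support ⊆ _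
      exact Finset.map_subset_map.2 hz
    have hcoord : ∀ z : LinkPoint M (baseVertex M σ), (h • z).coord ((h : ArtinGroup M) • u) =
        z.coord u := by
      intro z
      change z.coord ((h : ArtinGroup M)⁻¹ • (h : ArtinGroup M) • u) = _
      rw [inv_smul_smul]
    refine ⟨_, map_mem_link M hstab hs, (h : ArtinGroup M) • u, (h : ArtinGroup M) • w, ?_,
      hsupp x hx, hsupp y hy, ?_⟩
    · rw [Finset.coe_map, he, Set.image_pair]
      rfl
    · rw [hcoord, hcoord]
      rfl
  have hstr : ∀ {x y : LinkPoint M (baseVertex M σ)} {L : ℝ},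
      IsString M (baseVertex M σ) x y L → IsString M (baseVertex M σ) (h • x) (h • y) L := by
    intro x y L hL
    induction hL with
    | nil x => exact IsString.nil _
    | cons h _ ih => exact IsString.cons (harc h) ih
  exact le_iInf₂ fun L hL => edist_le_of_isString (hstr hL)

theorem edist_smul_smul {σ : KVertex M} (h : localGroup M σ)
    (x y : LinkPoint M (baseVertex M σ)) : edist (h • x) (h • y) = edist x y := by
  refine le_antisymm (edist_smul_le h x y) ?_
  have := edist_smul_le h⁻¹ (h • x) (h • y)
  rwa [inv_smul_smul, inv_smul_smul] at this

variable {a b : V} (hab : M a b ≠ 0)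

/-- The link of `v_{ab}`. -/
abbrev PairLink : Type _ := LinkPoint M (baseVertex M (pairVertex M a b hab))

/-- Each point of the link lies on an edge. -/
theorem exists_support_subset_linkEdge (hne : a ≠ b) (x : PairLink hab) :
    ∃ g : localGroup M (pairVertex M a b hab), ∃ c ∈ ({a, b} : Set V),
      x.coord.support ⊆ linkEdge c (g : ArtinGroup M) := by
  obtain ⟨g, hg, c, hc, h⟩ := exists_edge_of_mem_link hab hne x.support_mem
  exact ⟨⟨g, hg⟩, c, hc, h⟩

theorem singleton_mem_link (hne : a ≠ b) {g : ArtinGroup M}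
    (hg : g ∈ localGroup M (pairVertex M a b hab)) {c : V} (hc : c ∈ ({a, b} : Set V))
    {u : DVertex M} (hu : u ∈ linkEdge c g) :
    {u} ∈ (link M (baseVertex M (pairVertex M a b hab))).faces :=
  ((link M _).isRelLowerSet_faces (edge_mem_link hab hne hg hc)).2
    (Finset.singleton_subset_iff.2 hu) (Finset.singleton_nonempty u)

theorem edist_le_of_support_subset (hm : 3 ≤ M a b) {x y : PairLink hab}
    {g : ArtinGroup M} (hg : g ∈ localGroup M (pairVertex M a b hab)) {c : V}
    (hc : c ∈ ({a, b} : Set V)) (hx : x.coord.support ⊆ linkEdge c g)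
    (hy : y.coord.support ⊆ linkEdge c g) :
    edist x y ≤ ENNReal.ofReal (Real.pi / (2 * M a b)) := by
  have hne : a ≠ b := by
    rintro rfl
    rw [M.diagonal] at hm
    omega
  have harc : ArcStep M (baseVertex M (pairVertex M a b hab)) x y _ :=
    ⟨linkEdge c g, edge_mem_link hab hne hg hc, emptyVertex M g, singletonVertex M c g,
      by simp [linkEdge], hx, hy, rfl⟩
  refine (edist_le_of_isString (IsString.cons harc (IsString.nil y))).trans
    (ENNReal.ofReal_le_ofReal ?_)
  rw [angle_pairVertex hab hm hc (mem_linkEdge.2 (Or.inl rfl)) (mem_linkEdge.2 (Or.inr rfl)),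
    add_zero]
  refine mul_le_of_le_one_right (by positivity) ?_
  have h1 := x.coord_le_one (emptyVertex M g)
  have h2 := y.coord_le_one (emptyVertex M g)
  have h3 := x.nonneg (emptyVertex M g)
  have h4 := y.nonneg (emptyVertex M g)
  rw [abs_le]
  constructor <;> linarith

/-- The affine extension to the link of the syllabic length of coset representatives, for the
representatives chosen by `Quotient.out`. -/
noncomputable def linkHeight (x : PairLink hab) : ℝ :=
  x.coord.sum fun u t => t * syllabicLength {gen M a, gen M b} u.2.out

/-- The syllabic lengths of representatives at the two ends of an edge differ by at most one. -/
theorem abs_syllabicLength_out_sub_le {g : ArtinGroup M}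
    (hg : g ∈ localGroup M (pairVertex M a b hab)) {c : V} (hc : c ∈ ({a, b} : Set V)) :
    |(syllabicLength {gen M a, gen M b} (emptyVertex M g).2.out : ℝ) -
      syllabicLength {gen M a, gen M b} (singletonVertex M c g).2.out| ≤ 1 := by
  obtain ⟨k, hk⟩ := exists_out_singletonVertex c g
  rw [out_emptyVertex, hk]
  rw [localGroup_pairVertex] at hg
  have hc' : gen M c ∈ ({gen M a, gen M b} : Set (ArtinGroup M)) := by
    rcases hc with rfl | rfl <;> simp
  have hcc := Subgroup.subset_closure hc'
  have e1 := syllabicLength_mul_le hg (zpow_mem hcc k)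
  have e2 := syllabicLength_mul_le (mul_mem hg (zpow_mem hcc k)) (zpow_mem hcc (-k))
  have e3 := syllabicLength_zpow_le hc' k
  have e4 := syllabicLength_zpow_le hc' (-k)
  rw [mul_assoc, ← zpow_add, add_neg_cancel, zpow_zero, mul_one] at e2
  have e5 : (syllabicLength {gen M a, gen M b} (g * gen M c ^ k) : ℝ) ≤
      syllabicLength {gen M a, gen M b} g + 1 := by exact_mod_cast e1.trans (by omega)
  have e6 : (syllabicLength {gen M a, gen M b} g : ℝ) ≤
      syllabicLength {gen M a, gen M b} (g * gen M c ^ k) + 1 := by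
    exact_mod_cast e2.trans (by omega)
  rw [abs_le]
  constructor <;> linarith

theorem linkHeight_eq {x : PairLink hab} {g : ArtinGroup M} {c : V}
    (hx : x.coord.support ⊆ linkEdge c g) :
    linkHeight hab x = syllabicLength {gen M a, gen M b} (singletonVertex M c g).2.out +
      x.coord (emptyVertex M g) *
        ((syllabicLength {gen M a, gen M b} (emptyVertex M g).2.out : ℝ) -
          syllabicLength {gen M a, gen M b} (singletonVertex M c g).2.out) := by
  have h1 := x.sum_eq hx
  rw [linkHeight, Finsupp.sum_of_support_subset _ hx _ (by simp)]
  rw [linkEdge, Finset.sum_cons, Finset.sum_singleton] at h1 ⊢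
  have h2 : x.coord (singletonVertex M c g) = 1 - x.coord (emptyVertex M g) := by linarith
  rw [h2]
  ring

/-- The height is a Lipschitz function on the link. -/
theorem abs_linkHeight_sub_le_edist (hm : 3 ≤ M a b) (x y : PairLink hab) :
    ENNReal.ofReal (Real.pi / (2 * M a b) * |linkHeight hab x - linkHeight hab y|) ≤
      edist x y := by
  have hne : a ≠ b := by
    rintro rfl
    rw [M.diagonal] at hm
    omega
  have harc : ∀ {x y : PairLink hab} {d : ℝ},
      ArcStep M (baseVertex M (pairVertex M a b hab)) x y d →
      Real.pi / (2 * M a b) * |linkHeight hab x - linkHeight hab y| ≤ d := by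
    rintro x y d ⟨s, hs, u, w, he, hx, hy, rfl⟩
    obtain ⟨g, hg, c, hc, hsg⟩ := exists_edge_of_mem_link hab hne hs
    have hu : u ∈ s := by rw [← Finset.mem_coe, he]; simp
    have hw : w ∈ s := by rw [← Finset.mem_coe, he]; simp
    rw [angle_pairVertex hab hm hc (hsg hu) (hsg hw)]
    refine mul_le_mul_of_nonneg_left ?_ (by positivity)
    rw [linkHeight_eq hab (hx.trans hsg), linkHeight_eq hab (hy.trans hsg), add_sub_add_left_eq_sub,
      ← sub_mul, abs_mul]
    refine (mul_le_of_le_one_right (abs_nonneg _)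
      (abs_syllabicLength_out_sub_le hab hg hc)).trans ?_
    have hone : ∀ z : PairLink hab, z.coord.support ⊆ s → ∀ t, s = {t} → z.coord t = 1 := by
      rintro z hz t rfl
      simpa using z.sum_eq hz
    have hx1 := x.sum_eq (hx.trans hsg)
    have hy1 := y.sum_eq (hy.trans hsg)
    rw [linkEdge, Finset.sum_cons, Finset.sum_singleton] at hx1 hy1
    rcases mem_linkEdge.1 (hsg hu) with rfl | rfl
    · exact le_rfl
    · have h1 : x.coord (emptyVertex M g) - y.coord (emptyVertex M g) =
          -(x.coord (singletonVertex M c g) - y.coord (singletonVertex M c g)) := by linarith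
      rw [h1, abs_neg]
  refine le_iInf₂ fun L hL => ENNReal.ofReal_le_ofReal ?_
  induction hL with
  | nil x => simp
  | @cons x y z d L h _ ih =>
    have h1 := harc h
    have h2 := abs_sub_le (linkHeight hab x) (linkHeight hab y) (linkHeight hab z)
    have h3 : 0 ≤ Real.pi / (2 * M a b) := by positivity
    nlinarith [mul_le_mul_of_nonneg_left h2 h3]

/-- Up to bounded errors, the displacement of a point of the link is bounded above and below by
multiples of the syllabic length. -/
theorem exists_displacement_bounds (hm : 3 ≤ M a b) :
    ∃ δ : ℝ≥0, 0 < δ ∧ ∀ x : PairLink hab, ∃ D : ℝ≥0,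
      ∀ h : localGroup M (pairVertex M a b hab),
        (δ : ℝ≥0∞) * syllabicLength {gen M a, gen M b} (h : ArtinGroup M) ≤
          edist x (h • x) + D ∧
        edist x (h • x) ≤
          2 * δ * syllabicLength {gen M a, gen M b} (h : ArtinGroup M) + D := by
  have hne : a ≠ b := by
    rintro rfl
    rw [M.diagonal] at hm
    omega
  have hm0 : (0 : ℝ) < M a b := by exact_mod_cast (by omega : 0 < M a b)
  set H := localGroup M (pairVertex M a b hab) with hH
  set δ : ℝ≥0 := (Real.pi / (2 * M a b)).toNNReal with hδ
  have hδpos : 0 < Real.pi / (2 * M a b) := by positivity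
  let P : H → PairLink hab := fun h =>
    vertexPoint (emptyVertex M h) (singleton_mem_link hab hne h.2 (c := a) (by simp)
      (mem_linkEdge.2 (Or.inl rfl)))
  have hPsupp : ∀ (h : H) (c : V), (P h).coord.support ⊆ linkEdge c (h : ArtinGroup M) := by
    intro h c
    rw [support_vertexPoint, Finset.singleton_subset_iff]
    exact mem_linkEdge.2 (Or.inl rfl)
  have hPsmul : ∀ h : H, h • P 1 = P h := by
    intro h
    refine LinkPoint.ext ?_
    change (Finsupp.single (emptyVertex M ((1 : H) : ArtinGroup M)) (1 : ℝ)).equivMapDomain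
      (MulAction.toPerm (h : ArtinGroup M)) = Finsupp.single (emptyVertex M h) 1
    rw [Finsupp.equivMapDomain_single]
    congr 1
    change emptyVertex M ((h : ArtinGroup M) * 1) = _
    rw [mul_one]
  have hPheight : ∀ h : H,
      linkHeight hab (P h) = syllabicLength {gen M a, gen M b} (h : ArtinGroup M) := by
    intro h
    change (Finsupp.single (emptyVertex M (h : ArtinGroup M)) (1 : ℝ)).sum _ = _
    rw [Finsupp.sum_single_index (by simp), out_emptyVertex, one_mul]
  -- the height is `0` at `v_∅` and the syllabic length of `h` at `h v_∅`
  have hlower : ∀ h : H, (δ : ℝ≥0∞) * syllabicLength {gen M a, gen M b} (h : ArtinGroup M) ≤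
      edist (P 1) (P h) := by
    intro h
    refine le_trans (le_of_eq ?_) (abs_linkHeight_sub_le_edist hab hm (P 1) (P h))
    rw [hPheight, hPheight, Subgroup.coe_one, syllabicLength_one, Nat.cast_zero, zero_sub, abs_neg,
      Nat.abs_cast, ENNReal.ofReal_mul hδpos.le, ENNReal.ofReal_natCast]
    rfl
  -- a syllable of the generator `c` is crossed by two edges, through a vertex `g v_c`
  have hupper : ∀ h : H, edist (P 1) (P h) ≤
      2 * δ * syllabicLength {gen M a, gen M b} (h : ArtinGroup M) := by
    have hcl : H = Subgroup.closure {gen M a, gen M b} := localGroup_pairVertex hab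
    have key := fun (g : ArtinGroup M) (hg : g ∈ H) => syllables_induction
      (P := fun g n => ∀ hg : g ∈ H, edist (P 1) (P ⟨g, hg⟩) ≤ 2 * δ * n)
      (S := {gen M a, gen M b}) (g := g) ?_ ?_ (hcl ▸ hg)
    · exact fun h => key h h.2 h.2
    · intro h1
      simp [show (⟨1, h1⟩ : H) = 1 from rfl]
    · intro g hg n ih t ht k hgk
      rw [← hcl] at hg
      have hc : ∃ c ∈ ({a, b} : Set V), t = gen M c := by
        rcases ht with rfl | rfl
        exacts [⟨a, by simp, rfl⟩, ⟨b, by simp, rfl⟩]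
      obtain ⟨c, hc, rfl⟩ := hc
      have hv : singletonVertex M c g ∈ linkEdge c g := mem_linkEdge.2 (Or.inr rfl)
      let Q : PairLink hab := vertexPoint _ (singleton_mem_link hab hne hg hc hv)
      have e1 : edist (P ⟨g, hg⟩) Q ≤ δ :=
        edist_le_of_support_subset hab hm hg hc (hPsupp ⟨g, hg⟩ c) (by
          rw [support_vertexPoint, Finset.singleton_subset_iff]
          exact hv)
      have e2 : edist Q (P ⟨g * gen M c ^ k, hgk⟩) ≤ δ :=
        edist_le_of_support_subset hab hm hgk hc (by
          rw [support_vertexPoint, Finset.singleton_subset_iff]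
          exact mem_linkEdge.2 (Or.inr (singletonVertex_mul_zpow c g k).symm)) (hPsupp ⟨_, hgk⟩ c)
      calc edist (P 1) (P ⟨g * gen M c ^ k, hgk⟩)
          ≤ edist (P 1) (P ⟨g, hg⟩) + edist (P ⟨g, hg⟩) Q + edist Q (P ⟨g * gen M c ^ k, hgk⟩) :=
            edist_triangle4 _ _ _ _
        _ ≤ 2 * δ * n + δ + δ := by gcongr; exact ih hg
        _ = 2 * δ * ((n + 1 : ℕ) : ℝ≥0∞) := by push_cast; ring
  refine ⟨δ, Real.toNNReal_pos.2 hδpos, fun x => ?_⟩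
  have hfin : edist x (P 1) ≠ ⊤ := by
    obtain ⟨g, c, hc, hx⟩ := exists_support_subset_linkEdge hab hne x
    have e1 := edist_le_of_support_subset hab hm g.2 hc hx (hPsupp g c)
    refine ne_top_of_le_ne_top ?_ (edist_triangle x (P g) (P 1))
    rw [edist_comm (P g)]
    exact ENNReal.add_ne_top.2 ⟨ne_top_of_le_ne_top ENNReal.ofReal_ne_top e1,
      ne_top_of_le_ne_top (ENNReal.mul_ne_top (ENNReal.mul_ne_top (by simp) ENNReal.coe_ne_top)
        (ENNReal.natCast_ne_top _)) (hupper g)⟩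
  obtain ⟨d, hd⟩ : ∃ d : ℝ≥0, (d : ℝ≥0∞) = edist x (P 1) := ⟨_, ENNReal.coe_toNNReal hfin⟩
  refine ⟨d + d, fun h => ?_⟩
  have hd' : edist (h • x) (P h) = d := by rw [← hPsmul, edist_smul_smul, hd]
  constructor
  · calc _ ≤ edist (P 1) (P h) := hlower h
      _ ≤ edist (P 1) x + edist x (h • x) + edist (h • x) (P h) := edist_triangle4 _ _ _ _
      _ = edist x (h • x) + ((d + d : ℝ≥0) : ℝ≥0∞) := by
        rw [hd', edist_comm (P 1), ← hd]; push_cast; ring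
  · calc _ ≤ edist x (P 1) + edist (P 1) (P h) + edist (P h) (h • x) := edist_triangle4 _ _ _ _
      _ ≤ d + 2 * δ * syllabicLength {gen M a, gen M b} (h : ArtinGroup M) + d := by
        rw [edist_comm (P h), hd', ← hd]
        gcongr
        exact hupper h
      _ = _ := by push_cast; ring

end Metric

/-! ### Orbits of cyclic subgroups -/

section Orbits

variable {V : Type*} [DecidableEq V] {M : CoxeterMatrix V} {a b : V} (hab : M a b ≠ 0)

theorem edist_zpow_smul (g : localGroup M (pairVertex M a b hab)) (x : PairLink hab) (i j : ℤ) :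
    edist (g ^ i • x) (g ^ j • x) = edist x (g ^ (i - j).natAbs • x) := by
  have key : ∀ i j : ℤ, i ≤ j →
      edist (g ^ i • x) (g ^ j • x) = edist x (g ^ (i - j).natAbs • x) := by
    intro i j hij
    have h1 : j = i + ((i - j).natAbs : ℤ) := by omega
    nth_rewrite 1 [h1]
    rw [zpow_add, mul_smul, edist_smul_smul, zpow_natCast]
  rcases le_total i j with h | h
  · exact key i j h
  · rw [edist_comm, key j i h, ← Int.natAbs_neg, neg_sub]

theorem edist_int_eq_natAbs (i j : ℤ) : edist i j = ((i - j).natAbs : ℝ≥0∞) := by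
  rw [edist_dist, Int.dist_eq', Int.abs_eq_natAbs, Int.cast_natCast, ENNReal.ofReal_natCast]

theorem isQuasiIsometricEmbedding_of_linear (hm : 3 ≤ M a b)
    (g : localGroup M (pairVertex M a b hab)) (x : PairLink hab) {K C : ℕ}
    (h : ∀ n : ℕ, n ≤ K * syllabicLength {gen M a, gen M b} ((g : ArtinGroup M) ^ n) + C) :
    IsQuasiIsometricEmbedding fun n : ℤ => g ^ n • x := by
  obtain ⟨δ, hδ, hD⟩ := exists_displacement_bounds hab hm
  obtain ⟨D, hD⟩ := hD x
  have hg : (g : ArtinGroup M) ∈ Subgroup.closure {gen M a, gen M b} :=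
    localGroup_pairVertex hab ▸ g.2
  set ℓ := syllabicLength {gen M a, gen M b} (g : ArtinGroup M) with hℓ
  let κ : ℝ≥0 := max 1 (max (K / δ) (2 * δ * ℓ))
  have h1 : 1 ≤ κ := le_max_left _ _
  have h2 : K / δ ≤ κ := (le_max_left _ _).trans (le_max_right _ _)
  have h3 : 2 * δ * ℓ ≤ κ := (le_max_right _ _).trans (le_max_right _ _)
  refine ⟨κ, D + C, h1, fun i j => ?_⟩
  rw [edist_zpow_smul, edist_int_eq_natAbs]
  set n := (i - j).natAbs
  have hDn := hD (g ^ n)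
  rw [Subgroup.coe_pow] at hDn
  constructor
  · have hκ : (κ : ℝ≥0∞) ≠ 0 := by
      rw [ENNReal.coe_ne_zero]
      exact (zero_lt_one.trans_le h1).ne'
    rw [ENNReal.div_le_iff hκ ENNReal.coe_ne_top]
    have e1 : (n : ℝ≥0∞) ≤
        K * syllabicLength {gen M a, gen M b} ((g : ArtinGroup M) ^ n) + C := by
      exact_mod_cast h n
    have hK : (K : ℝ≥0∞) = ((K / δ : ℝ≥0) : ℝ≥0∞) * δ := by
      rw [← ENNReal.coe_mul, div_mul_cancel₀ _ hδ.ne', ENNReal.coe_natCast]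
    calc (n : ℝ≥0∞) ≤ ((K / δ : ℝ≥0) : ℝ≥0∞) *
          (δ * syllabicLength {gen M a, gen M b} ((g : ArtinGroup M) ^ n)) + 1 * C := by
          rw [← mul_assoc, ← hK, one_mul]; exact e1
      _ ≤ κ * (edist x (g ^ n • x) + D) + κ * C := by
          gcongr
          · exact hDn.1
          · exact_mod_cast h1
      _ = (edist x (g ^ n • x) + ((D + C : ℝ≥0) : ℝ≥0∞)) * κ := by push_cast; ring
  · calc edist x (g ^ n • x) ≤
          2 * δ * syllabicLength {gen M a, gen M b} ((g : ArtinGroup M) ^ n) + D := hDn.2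
      _ ≤ 2 * δ * (n * ℓ : ℕ) + D := by
          gcongr
          exact syllabicLength_pow_le hg n
      _ = ((2 * δ * ℓ : ℝ≥0) : ℝ≥0∞) * n + D := by push_cast; ring
      _ ≤ κ * n + ((D + C : ℝ≥0) : ℝ≥0∞) := by
          gcongr
          exact le_self_add

theorem not_isQuasiIsometricEmbedding_of_bounded (hm : 3 ≤ M a b)
    (g : localGroup M (pairVertex M a b hab)) (x : PairLink hab) {B : ℕ}
    (h : ∀ n : ℕ, syllabicLength {gen M a, gen M b} ((g : ArtinGroup M) ^ n) ≤ B) :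
    ¬ IsQuasiIsometricEmbedding fun n : ℤ => g ^ n • x := by
  rintro ⟨κ, C, hκ, hqi⟩
  obtain ⟨δ, -, hD⟩ := exists_displacement_bounds hab hm
  obtain ⟨D, hD⟩ := hD x
  have hκ0 : (κ : ℝ≥0∞) ≠ 0 := by
    rw [ENNReal.coe_ne_zero]
    exact (zero_lt_one.trans_le hκ).ne'
  have key : ∀ n : ℕ, (n : ℝ≥0) ≤ (2 * δ * B + D + C) * κ := by
    intro n
    have h1 := (hqi 0 n).1
    rw [edist_zpow_smul, edist_int_eq_natAbs, ENNReal.div_le_iff hκ0 ENNReal.coe_ne_top,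
      zero_sub, Int.natAbs_neg, Int.natAbs_natCast] at h1
    have h2 := (hD (g ^ n)).2
    rw [Subgroup.coe_pow] at h2
    have h3 : (n : ℝ≥0∞) ≤ (2 * δ * B + D + C) * κ := by
      refine h1.trans ?_
      gcongr
      refine h2.trans ?_
      gcongr
      exact h n
    exact_mod_cast h3
  obtain ⟨n, hn⟩ := exists_nat_gt ((2 * δ * B + D + C) * κ)
  exact absurd (key n) (not_le.2 hn)

theorem growsLinearly_of_linear {u : ℕ → ℕ} {K C ℓ : ℕ} (h : ∀ n, n ≤ K * u n + C)
    (hu : ∀ n, u n ≤ n * ℓ) : GrowsLinearly u := by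
  refine ⟨1 / (K + 1), ℓ + 1, C, by positivity, ?_, by positivity, fun n => ⟨?_, ?_⟩⟩
  · have : (1 : ℝ) / (K + 1) ≤ 1 := by
      rw [div_le_one (by positivity)]
      linarith [Nat.cast_nonneg (α := ℝ) K]
    linarith [Nat.cast_nonneg (α := ℝ) ℓ]
  · have h1 : (n : ℝ) ≤ K * u n + C := by exact_mod_cast h n
    have h2 : (0 : ℝ) ≤ u n := Nat.cast_nonneg _
    have h3 : (0 : ℝ) ≤ C := Nat.cast_nonneg _
    have h4 : (0 : ℝ) ≤ K := Nat.cast_nonneg _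
    rw [sub_le_iff_le_add, one_div, inv_mul_le_iff₀ (by positivity)]
    nlinarith [mul_nonneg h4 h3]
  · have h1 : (u n : ℝ) ≤ n * ℓ := by exact_mod_cast hu n
    have h2 : (0 : ℝ) ≤ n := Nat.cast_nonneg _
    have h3 : (0 : ℝ) ≤ C := Nat.cast_nonneg _
    linarith

theorem not_growsLinearly_of_bounded {u : ℕ → ℕ} {B : ℕ} (h : ∀ n, u n ≤ B) :
    ¬ GrowsLinearly u := by
  rintro ⟨A, _, C, hA, -, -, hu⟩
  obtain ⟨n, hn⟩ := exists_nat_gt ((B + C) / A)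
  have h1 := (hu n).1
  have h2 : (u n : ℝ) ≤ B := by exact_mod_cast h n
  rw [div_lt_iff₀ hA] at hn
  linarith

/-- The excluded elements have powers of bounded syllabic length. -/
theorem exists_bound_of_conj {g : localGroup M (pairVertex M a b hab)}
    (h : ¬ (g ≠ 1 ∧ ¬ ∃ h : localGroup M (pairVertex M a b hab), ∃ s ∈ ({a, b} : Set V), ∃ k : ℤ,
      (g : ArtinGroup M) = h * gen M s ^ k * (h : ArtinGroup M)⁻¹)) :
    ∃ B, ∀ n : ℕ, syllabicLength {gen M a, gen M b} ((g : ArtinGroup M) ^ n) ≤ B := by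
  by_cases hg : g = 1
  · subst hg
    exact ⟨0, fun n => by rw [Subgroup.coe_one, one_pow, syllabicLength_one]⟩
  · obtain ⟨x, s, hs, k, hk⟩ := not_not.1 (not_and.1 h hg)
    have hs' : gen M s ∈ ({gen M a, gen M b} : Set (ArtinGroup M)) := by
      rcases hs with rfl | rfl <;> simp
    have hx : (x : ArtinGroup M) ∈ Subgroup.closure {gen M a, gen M b} :=
      localGroup_pairVertex hab ▸ x.2
    exact ⟨_, fun n => (congrArg (fun z => syllabicLength _ (z ^ n)) hk).le.trans
      (syllabicLength_pow_conj_le hx hs' k n)⟩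

end Orbits

end ArtinDeligne

theorem propositionE {V : Type*} [Fintype V] [DecidableEq V] (M : CoxeterMatrix V)
    (hdim : ArtinDeligne.HasDimension M 2) (hrank : 3 ≤ Fintype.card V)
    (a b : V) (hab : M a b ≠ 0) (hm : 3 ≤ M a b) :
    -- the orbits of `A_ab` on the link of `v_{ab}` are unbounded
    (∀ x : ArtinDeligne.LinkPoint M
        (ArtinDeligne.baseVertex M (ArtinDeligne.pairVertex M a b hab)),
      ∀ R : ℝ≥0, ∃ g : ArtinDeligne.localGroup M (ArtinDeligne.pairVertex M a b hab),
        (R : ℝ≥0∞) < edist x (g • x) ∧ edist x (g • x) ≠ ⊤) ∧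
    -- the orbits of `⟨g⟩` are quasi-isometrically embedded exactly for the elements `g` described
    (∀ g : ArtinDeligne.localGroup M (ArtinDeligne.pairVertex M a b hab),
      ∀ x : ArtinDeligne.LinkPoint M
          (ArtinDeligne.baseVertex M (ArtinDeligne.pairVertex M a b hab)),
        ArtinDeligne.IsQuasiIsometricEmbedding (fun n : ℤ => g ^ n • x) ↔
          g ≠ 1 ∧ ¬ ∃ h : ArtinDeligne.localGroup M (ArtinDeligne.pairVertex M a b hab),
            ∃ s ∈ ({a, b} : Set V), ∃ k : ℤ,
              (g : ArtinDeligne.ArtinGroup M) =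
                h * ArtinDeligne.gen M s ^ k * (h : ArtinDeligne.ArtinGroup M)⁻¹) ∧
    -- the syllabic length is unbounded on `A_ab`
    (∀ N : ℕ, ∃ g : ArtinDeligne.localGroup M (ArtinDeligne.pairVertex M a b hab),
      N < ArtinDeligne.syllabicLength {ArtinDeligne.gen M a, ArtinDeligne.gen M b}
        (g : ArtinDeligne.ArtinGroup M)) ∧
    -- the syllabic length of `g ^ n` grows linearly exactly for the same elements `g`
    (∀ g : ArtinDeligne.localGroup M (ArtinDeligne.pairVertex M a b hab),
      ArtinDeligne.GrowsLinearly (fun n : ℕ =>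
          ArtinDeligne.syllabicLength {ArtinDeligne.gen M a, ArtinDeligne.gen M b}
            ((g : ArtinDeligne.ArtinGroup M) ^ n)) ↔
        g ≠ 1 ∧ ¬ ∃ h : ArtinDeligne.localGroup M (ArtinDeligne.pairVertex M a b hab),
          ∃ s ∈ ({a, b} : Set V), ∃ k : ℤ,
            (g : ArtinDeligne.ArtinGroup M) =
              h * ArtinDeligne.gen M s ^ k * (h : ArtinDeligne.ArtinGroup M)⁻¹) := by
  have hH := ArtinDeligne.localGroup_pairVertex hab
  refine ⟨fun x R => ?_, fun g x => ⟨fun hqi => ?_, fun hg => ?_⟩,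
    ArtinDeligne.exists_lt_syllabicLength M hm hH, fun g => ⟨fun hgrow => ?_, fun hg => ?_⟩⟩
  · obtain ⟨δ, hδ, hD⟩ := ArtinDeligne.exists_displacement_bounds hab hm
    obtain ⟨D, hD⟩ := hD x
    obtain ⟨N, hN⟩ := exists_nat_gt ((R + D) / δ)
    obtain ⟨g, hg⟩ := ArtinDeligne.exists_lt_syllabicLength M hm hH N
    refine ⟨g, ?_, ?_⟩
    · rw [div_lt_iff₀ hδ, mul_comm] at hN
      have h1 : ((R + D : ℝ≥0) : ℝ≥0∞) < ((δ * N : ℝ≥0) : ℝ≥0∞) := ENNReal.coe_lt_coe.2 hN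
      have h2 : (δ : ℝ≥0∞) * N ≤ edist x (g • x) + D := by
        refine le_trans ?_ (hD g).1
        gcongr
      push_cast at h1
      exact lt_of_add_lt_add_right (h1.trans_le h2)
    · refine ne_top_of_le_ne_top ?_ (hD g).2
      exact ENNReal.add_ne_top.2 ⟨ENNReal.mul_ne_top (ENNReal.mul_ne_top (by simp)
        ENNReal.coe_ne_top) (ENNReal.natCast_ne_top _), ENNReal.coe_ne_top⟩
  · by_contra hg
    obtain ⟨B, hB⟩ := ArtinDeligne.exists_bound_of_conj hab hg
    exact ArtinDeligne.not_isQuasiIsometricEmbedding_of_bounded hab hm g x hB hqi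
  · obtain ⟨K, C, h⟩ := ArtinDeligne.syllabicLength_linear_lower_bound M hm hH hg.1 hg.2
    exact ArtinDeligne.isQuasiIsometricEmbedding_of_linear hab hm g x h
  · by_contra hg
    obtain ⟨B, hB⟩ := ArtinDeligne.exists_bound_of_conj hab hg
    exact ArtinDeligne.not_growsLinearly_of_bounded hB hgrow
  · obtain ⟨K, C, h⟩ := ArtinDeligne.syllabicLength_linear_lower_bound M hm hH hg.1 hg.2
    exact ArtinDeligne.growsLinearly_of_linear h
      (ArtinDeligne.syllabicLength_pow_le (hH ▸ g.2))
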